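/- Let $d\ge 1$, let $P$ be the law of $(X,Y)\in[0,1]^d\times\{0,1\}$, let $\Pi$ be the law of $X$, $\eta(x)=P(Y=1\mid X=x)$, $R(g)=P(g(X)\ne Y)$ for $g:[0,1]^d\to\{0,1\}$, and $g^*=\mathbf 1_{\{\eta\ge 1/2\}}$. For a function $h$ write $f_h=\max(h,1-h)$. Assume, for constants $s\ge 0$ and $\mu_{\min},\mu_{\max},C>0$: (1) $|\eta(x)-\eta(z)|\le s\|x-z\|_\infty$ for all $x,z\in[0,1]^d$; (2) $\Pi$ has a density $p_X$ on $[0,1]^d$ with $\mu_{\min}\le p_X\le\mu_{\max}$ on $[0,1]^d$; (3) $f_\eta(X)$ has a density bounded by $C$. *Parameters.* Let $N\ge 1$ be the label budget, $\delta\in(0,\tfrac12)$ and $c_N>1$. Put $N_0=\lfloor\sqrt N\rfloor$, $N_{k+1}=\lfloor c_N N_k\rfloor$, $r_k=N_k^{-1/(d+2)}$, $\varepsilon_0=1$ and, for $k\ge 1$, $$\varepsilon_k=\min\Big(1,\ \log\big(\tfrac N\delta\big)\log(N)\,N_{k-1}^{-1/(2+d)}\Big).$$ Let $\mathcal C_k$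 ($k\ge 0$) be the partition of $[0,1]^d$ into $m_k^d$ cubes of edge length $1/m_k$, where $m_k$ is a positive integer, $m_k$ divides $m_{k+1}$ (each partition refines the previous one), and $r_k/\kappa\le 1/m_k\le\kappa r_k$ for a constant $\kappa\ge 1$ (rounding the bandwidth $r_k$ to a power of $2$ gives such partitions with $\kappa=2$). *Algorithm.* Put $A_0=[0,1]^d$. At step $k\ge 0$, set $n_k=\lfloor N_k\Pi(A_k)\rfloor$ and, conditionally on the data of the earlier steps, draw i.i.d. pairs $(X_j,Y_j)_{j\le n_k}$ from the law of $(X,Y)$ conditioned on $X\in A_k$. The histogram estimator is $$\hat\eta_k(x)=\frac{\Pi(A_k)}{\Pi(R)}\,\frac1{n_k}\sum_{j=1}^{n_k}Y_j\mathbf 1_{\{X_j\in R\}},\qquad x\in R\in\mathcal C_k .$$ The next uncertain region is $$A_{k+1}=\{x\in A_k:\ f_{\hat\eta_k}(x)\le\lambda_{k+1}\},\qquad \lambda_{k+1}=\sup\{t:\ \Pi(\{f_{\hat\eta_k}\le t\}\cap A_k)\le\varepsilon_{k+1}\}.$$ The algorithm stops at the last step $L$ with $n_0+\dots+n_L\le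 N$, and returns $\hat g=\mathbf 1_{\{\hat\eta\ge 1/2\}}$ with $$\hat\eta=\sum_{j=0}^{L-1}\hat\eta_j\mathbf 1_{A_j\setminus A_{j+1}}+\hat\eta_L\mathbf 1_{A_L}.$$ **Theorem.** There are constants $K>0$ and $p\in\mathbb N$, depending only on $d,s,\mu_{\min},\mu_{\max},C,c_N,\kappa$, such that for all $N\ge 1$, all $\delta\in(0,\tfrac12)$ and all $P$ and $(m_k)$ as above, with probability at least $1-\delta$, $$R(\hat g)-R(g^*)\ \le\ K\,\log^p\!\big(\tfrac N\delta\big)\,N^{-\frac{2}{1+d}} .$$ -/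

import Mathlib

open MeasureTheory Set

noncomputable section

/-- The instance space `[0,1]^d`, inside `Fin d → ℝ` (which carries the sup norm). -/
def unitCube (d : ℕ) : Set (Fin d → ℝ) := Set.Icc 0 1

/-! ### The classification problem -/

/-- `η` is a version of the regression function `x ↦ P(Y = 1 | X = x)` on the cube, where `P` is the
law of the pair `(X, Y)` and the labels `1`, `0` are `true`, `false`. -/
structure IsRegressionFunction {d : ℕ} (P : Measure ((Fin d → ℝ) × Bool)) (η : (Fin d → ℝ) → ℝ) :
    Prop where
  mem_Icc : ∀ x ∈ unitCube d, η x ∈ Set.Icc (0 : ℝ) 1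
  aemeasurable : AEMeasurable η P.fst
  setLIntegral_eq : ∀ A : Set (Fin d → ℝ), MeasurableSet A →
    P (A ×ˢ {true}) = ∫⁻ x in A, ENNReal.ofReal (η x) ∂P.fst

/-- The score function `max(η, 1 - η)`. -/
def score {d : ℕ} (η : (Fin d → ℝ) → ℝ) (x : Fin d → ℝ) : ℝ := max (η x) (1 - η x)

/-- The plug-in classifier `1_{η ≥ 1/2}`. -/
def plugIn {d : ℕ} (η : (Fin d → ℝ) → ℝ) (x : Fin d → ℝ) : Bool :=
  open Classical in decide (1 / 2 ≤ η x)

/-- The misclassification risk `R(g) = P(g(X) ≠ Y)`. -/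
def risk {d : ℕ} (P : Measure ((Fin d → ℝ) × Bool)) (g : (Fin d → ℝ) → Bool) : ℝ :=
  P.real {z | g z.1 ≠ z.2}

/-- Smoothness: `η` is `s`-Lipschitz on the cube for the sup norm. -/
def IsSmooth {d : ℕ} (s : ℝ) (η : (Fin d → ℝ) → ℝ) : Prop :=
  ∀ x ∈ unitCube d, ∀ z ∈ unitCube d, |η x - η z| ≤ s * ‖x - z‖

/-- Strong density: `Π` has a density on the cube with values in `[μmin, μmax]`. -/
def HasStrongDensity {d : ℕ} (μmin μmax : ℝ) (Pi : Measure (Fin d → ℝ)) : Prop :=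
  ∃ p : (Fin d → ℝ) → ℝ, Measurable p ∧
    Pi = (volume.restrict (unitCube d)).withDensity (fun x => ENNReal.ofReal (p x)) ∧
    ∀ x ∈ unitCube d, μmin ≤ p x ∧ p x ≤ μmax

/-- Score regularity: the law of `f(X)`, for `X` of law `Π`, has a density bounded by `C`. -/
def HasBoundedScoreDensity {d : ℕ} (C : ℝ) (Pi : Measure (Fin d → ℝ)) (f : (Fin d → ℝ) → ℝ) :
    Prop :=
  ∃ q : ℝ → ℝ, Measurable q ∧ (∀ t, 0 ≤ q t ∧ q t ≤ C) ∧
    Pi.map f = volume.withDensity (fun t => ENNReal.ofReal (q t))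

/-! ### Cubic partitions and the histogram rule -/

/-- Coordinates of the cell containing `x` in the partition of `[0,1]^d` into `m^d` cubes of edge
length `1/m` (half-open, except at the upper faces of the cube). -/
def gridIndex {d : ℕ} (m : ℕ) (x : Fin d → ℝ) (i : Fin d) : ℕ := min ⌊(m : ℝ) * x i⌋₊ (m - 1)

/-- The cell containing `x` of the cubic partition with edge length `1/m`. -/
def gridCell {d : ℕ} (m : ℕ) (x : Fin d → ℝ) : Set (Fin d → ℝ) :=
  {z | z ∈ unitCube d ∧ ∀ i, gridIndex m z i = gridIndex m x i}

/-- The histogram rule on `A` with edge length `1/m`, computed from the first `n` terms of the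
labelled sample `D`: on a cell `R` it is `(Π(A) / Π(R)) * (1/n) * ∑_j Y_j 1_{X_j ∈ R}`. -/
def histogram {d : ℕ} (Pi : Measure (Fin d → ℝ)) (A : Set (Fin d → ℝ)) (n m : ℕ)
    (D : ℕ → (Fin d → ℝ) × Bool) (x : Fin d → ℝ) : ℝ :=
  Pi.real A / Pi.real (gridCell m x) *
    ((1 / (n : ℝ)) * ∑ j ∈ Finset.range n,
      (if (D j).2 then (1 : ℝ) else 0) * (gridCell m x).indicator (fun _ => (1 : ℝ)) (D j).1)

/-! ### The algorithm, as a function of the data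

`P` is the law of `(X, Y)` (only its marginal `P.fst` is used by the algorithm), `N` the label
budget, `1 - δ` the confidence level, `cN` the growth factor, `m k` the number of subdivisions of
each side of the cube at step `k`, and `D k i` the `i`-th labelled point drawn at step `k`. -/

/-- `N_0 = ⌊√N⌋` and `N_{k+1} = ⌊cN * N_k⌋`. -/
def stepSize (cN : ℝ) (N : ℕ) : ℕ → ℕ
  | 0 => Nat.sqrt N
  | k + 1 => ⌊cN * (stepSize cN N k : ℝ)⌋₊

/-- The bandwidth `r_k = N_k^{-1/(d+2)}`. -/
def bandwidth (d : ℕ) (cN : ℝ) (N k : ℕ) : ℝ :=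
  (stepSize cN N k : ℝ) ^ (-(1 / ((d : ℝ) + 2)))

/-- The rejection rates: `ε_0 = 1` and
`ε_{k+1} = min(1, log(N/δ) * log N * N_k^{-1/(2+d)})`. -/
def rejectionRate (d : ℕ) (cN : ℝ) (N : ℕ) (δ : ℝ) : ℕ → ℝ
  | 0 => 1
  | k + 1 => min 1 (Real.log ((N : ℝ) / δ) * Real.log (N : ℝ) *
      (stepSize cN N k : ℝ) ^ (-(1 / (2 + (d : ℝ)))))

/-- Number of labels requested at a step with parameter `Nk` and uncertain region `A`:
`⌊Nk * Π(A)⌋`. -/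
def labelCount {d : ℕ} (Pi : Measure (Fin d → ℝ)) (Nk : ℕ) (A : Set (Fin d → ℝ)) : ℕ :=
  ⌊(Nk : ℝ) * Pi.real A⌋₊

/-- The threshold for the score `f` on `A` at rejection rate `ε`: the supremum of all `t` with
`Π({f ≤ t} ∩ A) ≤ ε`; it is `⊤` if `Π(A) ≤ ε`. -/
def threshold {d : ℕ} (Pi : Measure (Fin d → ℝ)) (A : Set (Fin d → ℝ)) (f : (Fin d → ℝ) → ℝ)
    (ε : ℝ) : EReal :=
  sSup {t : EReal | Pi.real {x | x ∈ A ∧ (f x : EReal) ≤ t} ≤ ε}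

/-- The uncertain regions: `A_0 = [0,1]^d` and `A_{k+1} = {x ∈ A_k | f̂_k(x) ≤ λ_{k+1}}`, where
`f̂_k` is the score of the histogram rule on `A_k`. -/
def region {d : ℕ} (P : Measure ((Fin d → ℝ) × Bool)) (N : ℕ) (δ cN : ℝ) (m : ℕ → ℕ)
    (D : ℕ → ℕ → (Fin d → ℝ) × Bool) : ℕ → Set (Fin d → ℝ)
  | 0 => unitCube d
  | k + 1 =>
    let A := region P N δ cN m D k
    let f := score (histogram P.fst A (labelCount P.fst (stepSize cN N k) A) (m k) (D k))
    {x | x ∈ A ∧ (f x : EReal) ≤ threshold P.fst A f (rejectionRate d cN N δ (k + 1))}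

/-- The estimator `η̂_k`: the histogram rule on `A_k` from `⌊N_k Π(A_k)⌋` labelled points. -/
def stepEstimator {d : ℕ} (P : Measure ((Fin d → ℝ) × Bool)) (N : ℕ) (δ cN : ℝ) (m : ℕ → ℕ)
    (D : ℕ → ℕ → (Fin d → ℝ) × Bool) (k : ℕ) : (Fin d → ℝ) → ℝ :=
  histogram P.fst (region P N δ cN m D k)
    (labelCount P.fst (stepSize cN N k) (region P N δ cN m D k)) (m k) (D k)

/-- Number of labels requested up to and including step `k`. -/
def labelsUsed {d : ℕ} (P : Measure ((Fin d → ℝ) × Bool)) (N : ℕ) (δ cN : ℝ) (m : ℕ → ℕ)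
    (D : ℕ → ℕ → (Fin d → ℝ) × Bool) (k : ℕ) : ℕ :=
  ∑ j ∈ Finset.range (k + 1), labelCount P.fst (stepSize cN N j) (region P N δ cN m D j)

/-- The last step `L` that the budget `N` allows (`labelsUsed` is nondecreasing in the step). -/
def lastStep {d : ℕ} (P : Measure ((Fin d → ℝ) × Bool)) (N : ℕ) (δ cN : ℝ) (m : ℕ → ℕ)
    (D : ℕ → ℕ → (Fin d → ℝ) × Bool) : ℕ :=
  sSup {k | labelsUsed P N δ cN m D k ≤ N}

/-- `η̂ = ∑_{j < L} η̂_j 1_{A_j \ A_{j+1}} + η̂_L 1_{A_L}`. -/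
def finalEstimator {d : ℕ} (P : Measure ((Fin d → ℝ) × Bool)) (N : ℕ) (δ cN : ℝ) (m : ℕ → ℕ)
    (D : ℕ → ℕ → (Fin d → ℝ) × Bool) (x : Fin d → ℝ) : ℝ :=
  (∑ j ∈ Finset.range (lastStep P N δ cN m D),
    (region P N δ cN m D j \ region P N δ cN m D (j + 1)).indicator
      (stepEstimator P N δ cN m D j) x) +
  (region P N δ cN m D (lastStep P N δ cN m D)).indicator
    (stepEstimator P N δ cN m D (lastStep P N δ cN m D)) x

/-- The classifier returned by the algorithm. -/
def activeClassifier {d : ℕ} (P : Measure ((Fin d → ℝ) × Bool)) (N : ℕ) (δ cN : ℝ) (m : ℕ → ℕ)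
    (D : ℕ → ℕ → (Fin d → ℝ) × Bool) : (Fin d → ℝ) → Bool :=
  plugIn (finalEstimator P N δ cN m D)

/-! ### Active sampling -/

/-- The σ-algebra generated by the data of all steps before step `k`. -/
abbrev pastData {Ω S : Type*} [MeasurableSpace S] (Z : ℕ → ℕ → Ω → S) (k : ℕ) : MeasurableSpace Ω :=
  ⨆ j : ℕ, ⨆ _ : j < k, ⨆ i : ℕ, MeasurableSpace.comap (Z j i) inferInstance

/-- Active sampling: conditionally on the data of the steps before step `k`, the labelled points
`Z k 0, Z k 1, …` are i.i.d. with the law of `(X, Y)` conditioned on `X ∈ A k`; that is, `X` has law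
`Π(· | A k)` and, given `X`, `Y` is Bernoulli of parameter `η(X)`. The sequence at each step is an
infinite supply, of which the algorithm uses finitely many terms. -/
structure IsActiveSample {d : ℕ} {Ω : Type*} [MeasurableSpace Ω] (μ : Measure Ω)
    (P : Measure ((Fin d → ℝ) × Bool)) (A : ℕ → Ω → Set (Fin d → ℝ))
    (Z : ℕ → ℕ → Ω → (Fin d → ℝ) × Bool) : Prop where
  measurable : ∀ k i, Measurable (Z k i)
  cond_law : ∀ (k : ℕ) (S : Set Ω), MeasurableSet[pastData Z k] S →
    ∀ (n : ℕ) (T : Fin n → Set ((Fin d → ℝ) × Bool)), (∀ i, MeasurableSet (T i)) →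
      μ (S ∩ {ω | ∀ i : Fin n, Z k i ω ∈ T i}) =
        ∫⁻ ω in S, ∏ i : Fin n, ProbabilityTheory.cond P (A k ω ×ˢ Set.univ) (T i) ∂μ

end

/-! ### Geometry of the cubic partitions -/

section Grid

variable {d : ℕ}

/-! Write `ℓ = log (N / δ)` and `r_k` for the bandwidth at step `k`. The proof has a probabilistic
half, uniform accuracy of the estimators, and a deterministic half, valid whenever that accuracy
holds.

Accuracy (`exists_stepEstimator_close`, `exists_all_steps_close`): every cell `R` is inside or
outside `A_k`, and `⌊N_k Π(A_k)⌋` points drawn in `A_k` put at least about `N_k Π(R)` points in `R ⊆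
A_k`, a number that no longer depends on `Π(A_k)`. It is at least of order `N_k r_k^d = r_k^{-2}`,
so the stochastic error is of order `ℓ r_k`, while the Lipschitz bias is of order `r_k`. The region
is random, but it takes countably many values determined by the past, so a Chernoff bound applies on
each slice and the slices are summed. A union bound over cells and steps gives `|η̂_k - η| ≤ Δ_k = c
ℓ r_k` on `A_k` for every `k` with `N_k ≤ N ^ 2`, with probability at least `1 - δ`. Every step that
the budget allows satisfies this restriction (`stepSize_le_sq_of_labelsUsed_le`).

Correctness (`half_le_stepEstimator_iff`): if a rejected point were within `Δ_j` of the decision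
boundary, all points with smaller estimated score would be within `3 Δ_j` of it. Their mass is at
most `3 C Δ_j ≤ ε_{j+1}` once `log N ≥ 3 C c`, whereas rejection requires mass larger than
`ε_{j+1}`. Hence errors occur only in `A_L`, within `Δ_L` of the boundary, and the excess risk is at
most `2 Δ_L · C Δ_L`, that is `r_L ^ 2` up to logarithms.

Budget (`real_region_succ_le`, `labelsUsed_succ_le`): accuracy also gives `Π(A_{j+1}) ≲ ε_{j+1} +
Δ_j`, so step `j + 1` costs about `N_j r_j` labels up to logarithms. There are `O(log N)` steps and
step `L + 1` overruns the budget, hence `N ≲ polylog · N_L r_L = polylog · r_L^{-(d+1)}`, and `r_L ^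
2 ≲ polylog · N^{-2/(d+1)}`. Budgets below a constant are covered by the trivial bound `1` on the
excess risk. -/

lemma gridIndex_lt {m : ℕ} (hm : 0 < m) (x : Fin d → ℝ) (i : Fin d) : gridIndex m x i < m := by
  unfold gridIndex
  have := min_le_right ⌊(m : ℝ) * x i⌋₊ (m - 1)
  omega

lemma measurable_gridIndex (m : ℕ) : Measurable (gridIndex (d := d) m) := by
  refine measurable_pi_lambda _ fun i => ?_
  unfold gridIndex
  exact (Nat.measurable_floor.comp (measurable_const.mul (measurable_pi_apply i))).min
    measurable_const

lemma measurableSet_unitCube : MeasurableSet (unitCube d) := measurableSet_Icc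

/-- The cell of the cubic partition with a given index. -/
def cellOf (m : ℕ) (v : Fin d → ℕ) : Set (Fin d → ℝ) := {z | z ∈ unitCube d ∧ gridIndex m z = v}

lemma measurableSet_cellOf (m : ℕ) (v : Fin d → ℕ) : MeasurableSet (cellOf m v) :=
  measurableSet_unitCube.inter (measurable_gridIndex m (measurableSet_singleton v))

lemma gridCell_eq_cellOf (m : ℕ) (x : Fin d → ℝ) : gridCell m x = cellOf m (gridIndex m x) := by
  ext z
  simp [gridCell, cellOf, funext_iff]

lemma measurableSet_gridCell (m : ℕ) (x : Fin d → ℝ) : MeasurableSet (gridCell m x) := by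
  rw [gridCell_eq_cellOf]
  exact measurableSet_cellOf m _

/-- Integer division by `q` is monotone, so it commutes with the truncation at the upper faces; this
keeps the partitions nested up to the boundary. -/
lemma gridIndex_of_dvd {m m' : ℕ} (h : m ∣ m') (hm' : 0 < m') (z : Fin d → ℝ) (i : Fin d) :
    gridIndex m z i = gridIndex m' z i / (m' / m) := by
  obtain ⟨q, rfl⟩ := h
  have hm : 0 < m := Nat.pos_of_mul_pos_right hm'
  have hq : 0 < q := Nat.pos_of_mul_pos_left hm'
  rw [Nat.mul_div_cancel_left q hm]
  unfold gridIndex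
  have h1 : ⌊(m : ℝ) * z i⌋₊ = ⌊((m * q : ℕ) : ℝ) * z i⌋₊ / q := by
    rw [← Nat.floor_div_natCast]
    congr 1
    push_cast
    field_simp
  have h2 : m - 1 = (m * q - 1) / q := by
    symm
    rw [Nat.div_eq_iff hq]
    obtain ⟨a, rfl⟩ : ∃ a, m = a + 1 := ⟨m - 1, by omega⟩
    obtain ⟨b, rfl⟩ : ∃ b, q = b + 1 := ⟨q - 1, by omega⟩
    simp only [Nat.add_sub_cancel]
    have : (a + 1) * (b + 1) = a * (b + 1) + b + 1 := by ring
    omega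
  rw [h1, h2]
  have hmono : Monotone fun a : ℕ => a / q := fun a b hab => Nat.div_le_div_right hab
  exact hmono.map_min.symm

lemma gridCell_anti {m m' : ℕ} (h : m ∣ m') (hm' : 0 < m') (x : Fin d → ℝ) :
    gridCell m' x ⊆ gridCell m x := by
  rintro z ⟨hz, hi⟩
  refine ⟨hz, fun i => ?_⟩
  rw [gridIndex_of_dvd h hm', gridIndex_of_dvd h hm', hi i]

lemma gridIndex_bounds {m : ℕ} (hm : 0 < m) {x : Fin d → ℝ} (hx : x ∈ unitCube d) (i : Fin d) :
    (gridIndex m x i : ℝ) ≤ m * x i ∧ (m : ℝ) * x i ≤ gridIndex m x i + 1 := by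
  have h0 : 0 ≤ x i := hx.1 i
  have h1 : x i ≤ 1 := hx.2 i
  have hmR : (0 : ℝ) < m := by exact_mod_cast hm
  have hmx : 0 ≤ (m : ℝ) * x i := by positivity
  constructor
  · calc (gridIndex m x i : ℝ) ≤ (⌊(m : ℝ) * x i⌋₊ : ℝ) := by
          exact_mod_cast min_le_left _ _
      _ ≤ _ := Nat.floor_le hmx
  · unfold gridIndex
    rcases le_total ⌊(m : ℝ) * x i⌋₊ (m - 1) with h | h
    · rw [min_eq_left h]
      exact (Nat.lt_floor_add_one _).le
    · rw [min_eq_right h, Nat.cast_sub hm]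
      push_cast
      nlinarith

lemma norm_sub_le_of_mem_gridCell {m : ℕ} (hm : 0 < m) {x z : Fin d → ℝ} (hx : x ∈ unitCube d)
    (hz : z ∈ gridCell m x) : ‖z - x‖ ≤ 1 / m := by
  have hmR : (0 : ℝ) < m := by exact_mod_cast hm
  refine (pi_norm_le_iff_of_nonneg (by positivity)).2 fun i => ?_
  have h1 := gridIndex_bounds hm hx i
  have h2 := gridIndex_bounds hm hz.1 i
  rw [hz.2 i] at h2
  rw [Pi.sub_apply, Real.norm_eq_abs, abs_le, le_div_iff₀ hmR, neg_le_iff_add_nonneg]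
  constructor
  · have : 0 ≤ (z i - x i + 1 / m) * m := by
      have : (z i - x i + 1 / m) * m = m * z i - m * x i + 1 := by field_simp
      linarith
    exact nonneg_of_mul_nonneg_left this hmR
  · linarith

/-- The half-open box with the same index lies in the cell; the convention at the upper faces only
enlarges the cell. -/
lemma volume_gridCell_ge {m : ℕ} (hm : 0 < m) {x : Fin d → ℝ} :
    ENNReal.ofReal ((1 / (m : ℝ)) ^ d) ≤ volume (gridCell m x) := by
  have hmR : (0 : ℝ) < m := by exact_mod_cast hm
  have hsub : (univ.pi fun i => Ico ((gridIndex m x i : ℝ) / m) ((gridIndex m x i + 1 : ℝ) / m)) ⊆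
      gridCell m x := by
    intro z hz
    have hz' : ∀ i, (gridIndex m x i : ℝ) / m ≤ z i ∧ z i < (gridIndex m x i + 1 : ℝ) / m :=
      fun i => hz i (mem_univ i)
    have hlt : ∀ i, (gridIndex m x i : ℝ) + 1 ≤ m := fun i => by
      exact_mod_cast gridIndex_lt hm x i
    have hnn : ∀ i, 0 ≤ z i := fun i => le_trans (by positivity) (hz' i).1
    refine ⟨⟨hnn, fun i => ?_⟩, fun i => ?_⟩
    · refine (hz' i).2.le.trans ?_
      rw [div_le_iff₀ hmR, Pi.one_apply, one_mul]
      exact hlt i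
    · have h1 := (hz' i).1
      have h2 := (hz' i).2
      rw [div_le_iff₀ hmR] at h1
      rw [lt_div_iff₀ hmR] at h2
      have hfl : ⌊(m : ℝ) * z i⌋₊ = gridIndex m x i := by
        rw [Nat.floor_eq_iff (mul_nonneg hmR.le (hnn i))]
        constructor <;> linarith
      have hlt' := gridIndex_lt hm x i
      conv_lhs => unfold gridIndex
      rw [hfl]
      omega
  refine le_trans (le_of_eq ?_) (measure_mono hsub)
  rw [Real.volume_pi_Ico]
  have : ∀ i : Fin d, (gridIndex m x i + 1 : ℝ) / m - (gridIndex m x i : ℝ) / m = 1 / m :=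
    fun i => by ring
  simp only [this, Finset.prod_const, Finset.card_univ, Fintype.card_fin]
  exact ENNReal.ofReal_pow (by positivity) d

lemma gridCell_eq_of_mem {m : ℕ} {x z : Fin d → ℝ} (hz : z ∈ gridCell m x) :
    gridCell m z = gridCell m x := by
  rw [gridCell_eq_cellOf, gridCell_eq_cellOf, show gridIndex m z = gridIndex m x from funext hz.2]

lemma histogram_eq_of_mem {m : ℕ} {x z : Fin d → ℝ} (hz : z ∈ gridCell m x)
    (Pi : Measure (Fin d → ℝ)) (A : Set (Fin d → ℝ)) (n : ℕ) (D : ℕ → (Fin d → ℝ) × Bool) :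
    histogram Pi A n m D z = histogram Pi A n m D x := by
  unfold histogram
  rw [gridCell_eq_of_mem hz]

lemma measurable_histogram (Pi : Measure (Fin d → ℝ)) (A : Set (Fin d → ℝ)) (n m : ℕ)
    (D : ℕ → (Fin d → ℝ) × Bool) : Measurable (histogram Pi A n m D) := by
  have : histogram Pi A n m D = (fun v : Fin d → ℕ => Pi.real A / Pi.real (cellOf m v) *
    ((1 / (n : ℝ)) * ∑ j ∈ Finset.range n,
      (if (D j).2 then (1 : ℝ) else 0) * (cellOf m v).indicator (fun _ => (1 : ℝ)) (D j).1)) ∘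
      gridIndex m := by
    ext x
    simp only [histogram, gridCell_eq_cellOf, Function.comp]
  rw [this]
  exact Measurable.of_discrete.comp (measurable_gridIndex m)

/-- A subset of the cube that is a union of cells of edge length `1 / m`. -/
structure IsCellUnion (m : ℕ) (A : Set (Fin d → ℝ)) : Prop where
  subset : A ⊆ unitCube d
  cell_subset : ∀ x ∈ A, gridCell m x ⊆ A

lemma IsCellUnion.measurableSet {m : ℕ} {A : Set (Fin d → ℝ)} (hA : IsCellUnion m A) :
    MeasurableSet A := by
  have : A = unitCube d ∩ gridIndex m ⁻¹' (gridIndex m '' A) := by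
    ext x
    constructor
    · exact fun hx => ⟨hA.subset hx, x, hx, rfl⟩
    · rintro ⟨hx, z, hz, hzx⟩
      exact hA.cell_subset z hz ⟨hx, fun i => by rw [hzx]⟩
  rw [this]
  exact measurableSet_unitCube.inter (measurable_gridIndex m (Set.to_countable _).measurableSet)

lemma isCellUnion_unitCube (m : ℕ) : IsCellUnion m (unitCube d) :=
  ⟨subset_rfl, fun _ _ _ hz => hz.1⟩

lemma IsCellUnion.of_dvd {m m' : ℕ} {A : Set (Fin d → ℝ)} (hA : IsCellUnion m A) (h : m ∣ m')
    (hm' : 0 < m') : IsCellUnion m' A :=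
  ⟨hA.subset, fun x hx => (gridCell_anti h hm' x).trans (hA.cell_subset x hx)⟩

end Grid

/-! ### Thresholds -/

section Threshold

variable {d : ℕ} {Pi : Measure (Fin d → ℝ)} {A : Set (Fin d → ℝ)} {f : (Fin d → ℝ) → ℝ} {ε : ℝ}

lemma measurableSet_sublevel (hA : MeasurableSet A) (hf : Measurable f) (t : EReal) :
    MeasurableSet {x | x ∈ A ∧ (f x : EReal) ≤ t} :=
  hA.inter (measurableSet_le (measurable_coe_real_ereal.comp hf) measurable_const)

lemma lt_real_of_threshold_lt {t : EReal} (ht : threshold Pi A f ε < t) :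
    ε < Pi.real {x | x ∈ A ∧ (f x : EReal) ≤ t} := by
  by_contra! h
  exact absurd (le_sSup (a := t) (s := {t : EReal | Pi.real {x | x ∈ A ∧ (f x : EReal) ≤ t} ≤ ε}) h)
    (not_le.2 ht)

lemma real_le_of_lt_threshold [IsFiniteMeasure Pi] {t : EReal} (ht : t < threshold Pi A f ε) :
    Pi.real {x | x ∈ A ∧ (f x : EReal) ≤ t} ≤ ε := by
  obtain ⟨s, hs, hts⟩ := lt_sSup_iff.1 ht
  refine le_trans (measureReal_mono ?_) hs
  exact fun x hx => ⟨hx.1, hx.2.trans hts.le⟩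

/-- Continuity of the measure along levels increasing to the threshold. The inequality must be
strict: a histogram score is piecewise constant, so its level set at the threshold may have positive
mass. -/
lemma real_lt_threshold_le [IsFiniteMeasure Pi] (hε : 0 ≤ ε) :
    Pi.real {x | x ∈ A ∧ (f x : EReal) < threshold Pi A f ε} ≤ ε := by
  rcases eq_bot_or_bot_lt (threshold Pi A f ε) with h | h
  · simp [h, hε]
  obtain ⟨u, hu, hmem, hlim⟩ := exists_seq_strictMono_tendsto' h
  have hU : {x | x ∈ A ∧ (f x : EReal) < threshold Pi A f ε} =
      ⋃ n, {x | x ∈ A ∧ (f x : EReal) ≤ u n} := by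
    ext x
    simp only [mem_ofPred_eq, mem_iUnion]
    constructor
    · rintro ⟨hx, hlt⟩
      obtain ⟨n, hn⟩ := (hlim.eventually (lt_mem_nhds hlt)).exists
      exact ⟨n, hx, hn.le⟩
    · rintro ⟨n, hx, hn⟩
      exact ⟨hx, hn.trans_lt (hmem n).2⟩
  have hmono : Monotone fun n => {x | x ∈ A ∧ (f x : EReal) ≤ u n} :=
    fun a b hab x hx => ⟨hx.1, hx.2.trans (hu.monotone hab)⟩
  have hT := tendsto_measure_iUnion_atTop (μ := Pi) hmono
  rw [← hU] at hT
  have hT' := (ENNReal.tendsto_toReal (measure_ne_top Pi _)).comp hT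
  exact le_of_tendsto' hT' fun n => real_le_of_lt_threshold (hmem n).2

/-- Levels decreasing to the threshold all have mass above `ε`, and the level set at the threshold
is their intersection. The minimum covers the threshold `⊤`, where the sublevel set is all of `A`.
-/
lemma min_le_real_le_threshold [IsFiniteMeasure Pi] (hA : MeasurableSet A) (hf : Measurable f) :
    min (Pi.real A) ε ≤ Pi.real {x | x ∈ A ∧ (f x : EReal) ≤ threshold Pi A f ε} := by
  rcases eq_top_or_lt_top (threshold Pi A f ε) with h | h
  · simp [h]
  refine (min_le_right _ _).trans ?_
  obtain ⟨u, hu, hmem, hlim⟩ := exists_seq_strictAnti_tendsto' h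
  have hU : {x | x ∈ A ∧ (f x : EReal) ≤ threshold Pi A f ε} =
      ⋂ n, {x | x ∈ A ∧ (f x : EReal) ≤ u n} := by
    ext x
    simp only [mem_ofPred_eq, mem_iInter]
    constructor
    · rintro ⟨hx, hle⟩ n
      exact ⟨hx, hle.trans (hmem n).1.le⟩
    · exact fun hx => ⟨(hx 0).1, ge_of_tendsto' hlim fun n => (hx n).2⟩
  have hanti : Antitone fun n => {x | x ∈ A ∧ (f x : EReal) ≤ u n} :=
    fun a b hab x hx => ⟨hx.1, hx.2.trans (hu.antitone hab)⟩
  have hT := tendsto_measure_iInter_atTop (μ := Pi)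
    (fun n => (measurableSet_sublevel hA hf (u n)).nullMeasurableSet) hanti
    ⟨0, measure_ne_top _ _⟩
  rw [← hU] at hT
  have hT' := (ENNReal.tendsto_toReal (measure_ne_top Pi _)).comp hT
  exact ge_of_tendsto' hT' fun n => (lt_real_of_threshold_lt (hmem n).1).le

end Threshold

/-! ### The distribution of the instances -/

section Distribution

variable {d : ℕ} {P : Measure ((Fin d → ℝ) × Bool)} {η : (Fin d → ℝ) → ℝ}

lemma real_gridCell_ge {μmin μmax : ℝ} {Pi : Measure (Fin d → ℝ)} [IsFiniteMeasure Pi]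
    (hμmin : 0 < μmin) (hPi : HasStrongDensity μmin μmax Pi) {m : ℕ} (hm : 0 < m)
    (x : Fin d → ℝ) : μmin * (1 / (m : ℝ)) ^ d ≤ Pi.real (gridCell m x) := by
  obtain ⟨p, hp, hPieq, hb⟩ := hPi
  have hsub : gridCell m x ⊆ unitCube d := fun z hz => hz.1
  have hmeas := measurableSet_gridCell m x
  have key : ENNReal.ofReal (μmin * (1 / (m : ℝ)) ^ d) ≤ Pi (gridCell m x) := by
    rw [ENNReal.ofReal_mul hμmin.le]
    calc ENNReal.ofReal μmin * ENNReal.ofReal ((1 / (m : ℝ)) ^ d)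
        ≤ ENNReal.ofReal μmin * volume (gridCell m x) := by
          gcongr
          exact volume_gridCell_ge hm
      _ = ∫⁻ _ in gridCell m x, ENNReal.ofReal μmin := by rw [setLIntegral_const]
      _ ≤ ∫⁻ z in gridCell m x, ENNReal.ofReal (p z) :=
          setLIntegral_mono hp.ennreal_ofReal
            fun z hz => ENNReal.ofReal_le_ofReal (hb z (hsub hz)).1
      _ = Pi (gridCell m x) := by
          rw [hPieq, withDensity_apply _ hmeas, Measure.restrict_restrict hmeas,
            inter_eq_left.2 hsub]
  exact (ENNReal.ofReal_le_iff_le_toReal (measure_ne_top _ _)).1 key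

lemma measure_compl_unitCube {μmin μmax : ℝ} {Pi : Measure (Fin d → ℝ)}
    (hPi : HasStrongDensity μmin μmax Pi) : Pi (unitCube d)ᶜ = 0 := by
  obtain ⟨p, -, hPieq, -⟩ := hPi
  have h : (volume.restrict (unitCube d)) (unitCube d)ᶜ = 0 := by
    rw [Measure.restrict_apply measurableSet_unitCube.compl]
    simp
  rw [hPieq]
  exact withDensity_absolutelyContinuous _ _ h

lemma real_unitCube {μmin μmax : ℝ} {Pi : Measure (Fin d → ℝ)} [IsProbabilityMeasure Pi]
    (hPi : HasStrongDensity μmin μmax Pi) : Pi.real (unitCube d) = 1 := by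
  rw [measureReal_def, (prob_compl_eq_zero_iff measurableSet_unitCube).1
    (measure_compl_unitCube hPi), ENNReal.toReal_one]

lemma real_score_mem_Icc_le {C : ℝ} {Pi : Measure (Fin d → ℝ)} (hη : AEMeasurable η Pi)
    (hC : HasBoundedScoreDensity C Pi (score η)) {a b : ℝ} (hab : a ≤ b) :
    Pi.real {x | score η x ∈ Icc a b} ≤ C * (b - a) := by
  obtain ⟨q, hq, hb, hmap⟩ := hC
  have hC0 : 0 ≤ C := (hb 0).1.trans (hb 0).2
  have hsc : AEMeasurable (score η) Pi := hη.max (aemeasurable_const.sub hη)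
  have h1 : Pi {x | score η x ∈ Icc a b} = Pi.map (score η) (Icc a b) :=
    (Measure.map_apply_of_aemeasurable hsc measurableSet_Icc).symm
  have h2 : Pi {x | score η x ∈ Icc a b} ≤ ENNReal.ofReal (C * (b - a)) := by
    rw [h1, hmap, withDensity_apply _ measurableSet_Icc, ENNReal.ofReal_mul hC0]
    calc ∫⁻ t in Icc a b, ENNReal.ofReal (q t) ≤ ∫⁻ _ in Icc a b, ENNReal.ofReal C :=
          setLIntegral_mono measurable_const fun t _ => ENNReal.ofReal_le_ofReal (hb t).2
      _ = ENNReal.ofReal C * ENNReal.ofReal (b - a) := by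
          rw [setLIntegral_const, Real.volume_Icc]
  exact ENNReal.toReal_le_of_le_ofReal (mul_nonneg hC0 (sub_nonneg.2 hab)) h2

lemma half_le_score (x : Fin d → ℝ) : 1 / 2 ≤ score η x := by
  unfold score
  rcases le_total (η x) (1 / 2) with h | h
  · exact le_max_of_le_right (by linarith)
  · exact le_max_of_le_left h

lemma score_eq (x : Fin d → ℝ) : score η x = 1 / 2 + |η x - 1 / 2| := by
  unfold score
  rcases le_total (η x) (1 / 2) with h | h
  · rw [max_eq_right (by linarith), abs_of_nonpos (by linarith)]
    ring
  · rw [max_eq_left (by linarith), abs_of_nonneg (by linarith)]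
    ring

lemma abs_score_sub_score_le {η' : (Fin d → ℝ) → ℝ} (x : Fin d → ℝ) :
    |score η' x - score η x| ≤ |η' x - η x| := by
  rw [score_eq, score_eq]
  have := abs_abs_sub_abs_le_abs_sub (η' x - 1 / 2) (η x - 1 / 2)
  calc |1 / 2 + |η' x - 1 / 2| - (1 / 2 + |η x - 1 / 2|)|
      = |(|η' x - 1 / 2| - |η x - 1 / 2|)| := by ring_nf
    _ ≤ |η' x - 1 / 2 - (η x - 1 / 2)| := this
    _ = _ := by ring_nf

lemma real_prod_true_le [IsProbabilityMeasure P] (h : IsRegressionFunction P η)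
    {R : Set (Fin d → ℝ)} (hR : MeasurableSet R) {b : ℝ} (hb0 : 0 ≤ b) (hb : ∀ z ∈ R, η z ≤ b) :
    P.real (R ×ˢ {true}) ≤ b * P.fst.real R := by
  have h2 : P (R ×ˢ {true}) ≤ ENNReal.ofReal b * P.fst R := by
    rw [h.setLIntegral_eq R hR, ← setLIntegral_const]
    exact setLIntegral_mono measurable_const fun t ht => ENNReal.ofReal_le_ofReal (hb t ht)
  have := ENNReal.toReal_mono (ENNReal.mul_ne_top ENNReal.ofReal_ne_top (measure_ne_top _ _)) h2
  rwa [ENNReal.toReal_mul, ENNReal.toReal_ofReal hb0] at this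

lemma real_prod_true_ge [IsProbabilityMeasure P] (h : IsRegressionFunction P η)
    {R : Set (Fin d → ℝ)} (hR : MeasurableSet R) {a : ℝ} (ha : ∀ z ∈ R, a ≤ η z) :
    a * P.fst.real R ≤ P.real (R ×ˢ {true}) := by
  rcases le_total a 0 with ha0 | ha0
  · exact (mul_nonpos_of_nonpos_of_nonneg ha0 measureReal_nonneg).trans measureReal_nonneg
  have h2 : ENNReal.ofReal a * P.fst R ≤ P (R ×ˢ {true}) := by
    rw [h.setLIntegral_eq R hR, ← setLIntegral_const]
    exact setLIntegral_mono_ae (h.aemeasurable.ennreal_ofReal.restrict)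
      (Filter.Eventually.of_forall fun t ht => ENNReal.ofReal_le_ofReal (ha t ht))
  have := ENNReal.toReal_mono (measure_ne_top _ _) h2
  rwa [ENNReal.toReal_mul, ENNReal.toReal_ofReal ha0] at this

lemma real_prod_false [IsProbabilityMeasure P] {R : Set (Fin d → ℝ)} (hR : MeasurableSet R) :
    P.real (R ×ˢ {false}) = P.fst.real R - P.real (R ×ˢ {true}) := by
  have h1 : P.fst.real R = P.real (R ×ˢ {true}) + P.real (R ×ˢ {false}) := by
    rw [measureReal_def, Measure.fst_apply hR, ← measureReal_def, ← measureReal_union]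
    · congr 1
      ext ⟨x, b⟩
      cases b <;> simp
    · rw [Set.disjoint_left]
      rintro ⟨x, b⟩ h1 h2
      simp_all
    · exact hR.prod (measurableSet_singleton _)
  linarith

lemma continuousOn_of_isSmooth {s : ℝ} (hs : IsSmooth s η) : ContinuousOn η (unitCube d) := by
  have : LipschitzOnWith (Real.toNNReal s) η (unitCube d) := by
    refine LipschitzOnWith.of_dist_le_mul fun x hx z hz => ?_
    rw [Real.dist_eq, dist_eq_norm]
    refine (hs x hx z hz).trans ?_
    gcongr
    exact Real.le_coe_toNNReal s
  exact this.continuousOn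

lemma measurableSet_half_le {s : ℝ} (hs : IsSmooth s η) :
    MeasurableSet (unitCube d ∩ {x | 1 / 2 ≤ η x}) :=
  ((continuousOn_of_isSmooth hs).preimage_isClosed_of_isClosed isClosed_Icc
    (isClosed_Ici (a := (1 / 2 : ℝ)))).measurableSet

/-- Meant for two classifiers that agree on `V` and take opposite values on `W₁` and `W₀`: the first
terms then cancel in the difference of risks, so neither `V` nor the error set needs to be
measurable. -/
lemma risk_decomp [IsProbabilityMeasure P] (hcube : P.fst (unitCube d)ᶜ = 0)
    {g : (Fin d → ℝ) → Bool} {W₁ W₀ V : Set (Fin d → ℝ)}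
    (hW₁ : MeasurableSet W₁) (hW₀ : MeasurableSet W₀)
    (h₁ : ∀ x ∈ W₁, g x = true) (h₀ : ∀ x ∈ W₀, g x = false)
    (hd1 : Disjoint W₁ W₀) (hd2 : Disjoint V (W₁ ∪ W₀)) (hun : V ∪ (W₁ ∪ W₀) = unitCube d) :
    risk P g = P.real ({z | g z.1 ≠ z.2} ∩ Prod.fst ⁻¹' V) + P.real (W₁ ×ˢ {false}) +
      P.real (W₀ ×ˢ {true}) := by
  have hnull : P (Prod.fst ⁻¹' (unitCube d)ᶜ) = 0 := by
    rwa [Measure.fst_apply measurableSet_unitCube.compl] at hcube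
  have e1 : P.real {z | g z.1 ≠ z.2} = P.real ({z | g z.1 ≠ z.2} ∩ Prod.fst ⁻¹' (unitCube d)) := by
    rw [measureReal_def, measureReal_def]
    congr 1
    refine (measure_inter_conull ?_).symm
    refine measure_mono_null ?_ hnull
    exact fun z hz => hz
  have e2 : {z : (Fin d → ℝ) × Bool | g z.1 ≠ z.2} ∩ Prod.fst ⁻¹' (unitCube d) =
      ({z | g z.1 ≠ z.2} ∩ Prod.fst ⁻¹' V) ∪ (W₁ ×ˢ {false} ∪ W₀ ×ˢ {true}) := by
    rw [← hun]
    ext ⟨x, b⟩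
    simp only [mem_inter_iff, mem_ofPred_eq, mem_preimage, mem_union, mem_prod, mem_singleton_iff]
    constructor
    · rintro ⟨hne, hx | hx | hx⟩
      · exact Or.inl ⟨hne, hx⟩
      · rw [h₁ x hx] at hne
        exact Or.inr (Or.inl ⟨hx, by cases b <;> simp_all⟩)
      · rw [h₀ x hx] at hne
        exact Or.inr (Or.inr ⟨hx, by cases b <;> simp_all⟩)
    · rintro (⟨hne, hx⟩ | ⟨hx, hb⟩ | ⟨hx, hb⟩)
      · exact ⟨hne, Or.inl hx⟩
      · exact ⟨by rw [h₁ x hx, hb]; simp, Or.inr (Or.inl hx)⟩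
      · exact ⟨by rw [h₀ x hx, hb]; simp, Or.inr (Or.inr hx)⟩
  have m1 := hW₁.prod (measurableSet_singleton false)
  have m0 := hW₀.prod (measurableSet_singleton true)
  unfold risk
  rw [e1, e2, measureReal_union _ (m1.union m0), measureReal_union _ m0, add_assoc]
  · rw [Set.disjoint_left]
    rintro ⟨x, b⟩ h1 h2
    exact Set.disjoint_left.1 hd1 h1.1 h2.1
  · rw [Set.disjoint_left]
    rintro ⟨x, b⟩ h1 (h2 | h2)
    · exact Set.disjoint_left.1 hd2 h1.2 (Or.inl h2.1)
    · exact Set.disjoint_left.1 hd2 h1.2 (Or.inr h2.1)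

/-- Replacing the optimal label at `x` by the other one costs `|2 η x - 1| ≤ 2 Δ` per unit of mass,
and this happens only on `W₁ ∪ W₀`. -/
lemma risk_plugIn_sub_risk_le [IsProbabilityMeasure P] (h : IsRegressionFunction P η) {s : ℝ}
    (hs : IsSmooth s η) (hcube : P.fst (unitCube d)ᶜ = 0) {η' : (Fin d → ℝ) → ℝ}
    (hη' : MeasurableSet (unitCube d ∩ {x | 1 / 2 ≤ η' x})) {Δ : ℝ}
    (hΔ : ∀ x ∈ unitCube d, plugIn η' x ≠ plugIn η x → |η x - 1 / 2| ≤ Δ) :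
    risk P (plugIn η') - risk P (plugIn η) ≤ 2 * Δ * P.fst.real {x | |η x - 1 / 2| ≤ Δ} := by
  set G' := unitCube d ∩ {x | 1 / 2 ≤ η' x} with hG'
  set G := unitCube d ∩ {x | 1 / 2 ≤ η x} with hG
  have mG : MeasurableSet G := measurableSet_half_le hs
  set W₁ := G' \ G with hW₁
  set W₀ := G \ G' with hW₀
  set V := unitCube d \ (W₁ ∪ W₀) with hV
  have m1 : MeasurableSet W₁ := hη'.diff mG
  have m0 : MeasurableSet W₀ := mG.diff hη'
  have hd1 : Disjoint W₁ W₀ := by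
    rw [Set.disjoint_left]
    exact fun x hx hx' => hx.2 hx'.1
  have hd2 : Disjoint V (W₁ ∪ W₀) := disjoint_sdiff_left
  have hsub : W₁ ∪ W₀ ⊆ unitCube d := by
    rintro x (hx | hx)
    · exact hx.1.1
    · exact hx.1.1
  have hun : V ∪ (W₁ ∪ W₀) = unitCube d := sdiff_union_of_subset hsub
  have a1 : ∀ x ∈ W₁, plugIn η' x = true ∧ plugIn η x = false := fun x hx => by
    have h1 : 1 / 2 ≤ η' x := hx.1.2
    have h2 : ¬ 1 / 2 ≤ η x := fun h2 => hx.2 ⟨hx.1.1, h2⟩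
    simp only [plugIn, h1, h2, decide_true, decide_false, and_self]
  have a0 : ∀ x ∈ W₀, plugIn η' x = false ∧ plugIn η x = true := fun x hx => by
    have h1 : 1 / 2 ≤ η x := hx.1.2
    have h2 : ¬ 1 / 2 ≤ η' x := fun h2 => hx.2 ⟨hx.1.1, h2⟩
    simp only [plugIn, h1, h2, decide_true, decide_false, and_self]
  have aV : ∀ x ∈ V, plugIn η' x = plugIn η x := fun x hx => by
    have : 1 / 2 ≤ η' x ↔ 1 / 2 ≤ η x := by
      constructor
      · intro h1
        by_contra h2
        exact hx.2 (Or.inl ⟨⟨hx.1, h1⟩, fun h => h2 h.2⟩)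
      · intro h1
        by_contra h2
        exact hx.2 (Or.inr ⟨⟨hx.1, h1⟩, fun h => h2 h.2⟩)
    simp only [plugIn, this]
  have r' := risk_decomp hcube m1 m0 (fun x hx => (a1 x hx).1) (fun x hx => (a0 x hx).1)
    hd1 hd2 hun
  have r := risk_decomp hcube m0 m1 (fun x hx => (a0 x hx).2) (fun x hx => (a1 x hx).2)
    hd1.symm (by rwa [union_comm]) (by rwa [union_comm W₀])
  have eV : {z : (Fin d → ℝ) × Bool | plugIn η' z.1 ≠ z.2} ∩ Prod.fst ⁻¹' V =
      {z | plugIn η z.1 ≠ z.2} ∩ Prod.fst ⁻¹' V := by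
    ext z
    simp only [mem_inter_iff, mem_ofPred_eq, mem_preimage]
    constructor
    · rintro ⟨hz, hv⟩
      exact ⟨by rwa [← aV z.1 hv], hv⟩
    · rintro ⟨hz, hv⟩
      exact ⟨by rwa [aV z.1 hv], hv⟩
  rw [eV] at r'
  have b1 : ∀ x ∈ W₁, |η x - 1 / 2| ≤ Δ := fun x hx =>
    hΔ x hx.1.1 (by rw [(a1 x hx).1, (a1 x hx).2]; simp)
  have b0 : ∀ x ∈ W₀, |η x - 1 / 2| ≤ Δ := fun x hx =>
    hΔ x hx.1.1 (by rw [(a0 x hx).1, (a0 x hx).2]; simp)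
  -- The sign of `Δ` is not assumed: a point of disagreement forces `0 ≤ Δ`, and without one the two
  -- risks are equal.
  rcases (W₁ ∪ W₀).eq_empty_or_nonempty with he | ⟨x₀, hx₀⟩
  · have e1 : W₁ = ∅ := subset_empty_iff.1 (he ▸ subset_union_left)
    have e0 : W₀ = ∅ := subset_empty_iff.1 (he ▸ subset_union_right)
    rw [e1, e0] at r r'
    simp only [empty_prod, measureReal_empty] at r r'
    rw [r, r', sub_self]
    rcases le_total 0 Δ with h0 | h0
    · positivity
    · rcases h0.lt_or_eq with h0 | h0
      · have : {x | |η x - 1 / 2| ≤ Δ} = ∅ := by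
          ext x
          simp only [mem_ofPred_eq, mem_empty_iff_false, iff_false, not_le]
          exact h0.trans_le (abs_nonneg _)
        rw [this]
        simp
      · simp [h0]
  have hΔ0 : 0 ≤ Δ := by
    rcases hx₀ with hx | hx
    · exact (abs_nonneg _).trans (b1 x₀ hx)
    · exact (abs_nonneg _).trans (b0 x₀ hx)
  have c1 := real_prod_true_ge h m1 (a := 1 / 2 - Δ)
    fun z hz => by linarith [(abs_le.1 (b1 z hz)).1]
  have c0 := real_prod_true_le h m0 (b := 1 / 2 + Δ) (by linarith)
    fun z hz => by linarith [(abs_le.1 (b0 z hz)).2]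
  have hsum : P.fst.real W₁ + P.fst.real W₀ ≤ P.fst.real {x | |η x - 1 / 2| ≤ Δ} := by
    rw [← measureReal_union hd1 m0]
    refine measureReal_mono ?_
    rintro x (hx | hx)
    · exact b1 x hx
    · exact b0 x hx
  rw [r, r', real_prod_false m1, real_prod_false m0]
  nlinarith [mul_le_mul_of_nonneg_left hsum hΔ0]

end Distribution

/-! ### Concentration of empirical frequencies -/

section Chernoff

lemma exp_mul_indicator_sub {S : Type*} {T : Set S} (l q : ℝ) (x : S) :
    Real.exp (l * (T.indicator (fun _ => (1 : ℝ)) x - q)) =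
      Real.exp (-(l * q)) + T.indicator (fun _ => Real.exp (-(l * q)) * (Real.exp l - 1)) x := by
  by_cases hx : x ∈ T
  · simp only [indicator_of_mem hx]
    rw [show l * (1 - q) = -(l * q) + l by ring, Real.exp_add]
    ring
  · simp only [indicator_of_notMem hx]
    rw [show l * (0 - q) = -(l * q) by ring, add_zero]

variable {S : Type*} [MeasurableSpace S] {Q : Measure S} [IsProbabilityMeasure Q] {T : Set S}

lemma integrable_exp_mul_indicator_sub (hT : MeasurableSet T) (l q : ℝ) :
    Integrable (fun x => Real.exp (l * (T.indicator (fun _ => (1 : ℝ)) x - q))) Q := by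
  simp only [exp_mul_indicator_sub]
  exact (integrable_const _).add ((integrable_const _).indicator hT)

/-- From `1 + q (e^l - 1) ≤ exp (q (e^l - 1))` and `e^l - 1 - l ≤ l ^ 2`. The factor `Q.real T` in
the exponent is essential, since the cells have small probability. -/
lemma integral_exp_mul_indicator_sub_le (hT : MeasurableSet T) {l : ℝ} (hl : |l| ≤ 1) :
    ∫ x, Real.exp (l * (T.indicator (fun _ => (1 : ℝ)) x - Q.real T)) ∂Q ≤
      Real.exp (Q.real T * l ^ 2) := by
  simp only [exp_mul_indicator_sub]
  rw [integral_add (integrable_const _) ((integrable_const _).indicator hT), integral_const,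
    integral_indicator_const _ hT]
  simp only [probReal_univ, smul_eq_mul, one_mul]
  have h1 : Q.real T * (Real.exp l - 1) + 1 ≤ Real.exp (Q.real T * (Real.exp l - 1)) :=
    Real.add_one_le_exp _
  have h2 : Real.exp l - 1 - l ≤ l ^ 2 := (le_abs_self _).trans (Real.abs_exp_sub_one_sub_id_le hl)
  calc Real.exp (-(l * Q.real T)) + Q.real T * (Real.exp (-(l * Q.real T)) * (Real.exp l - 1))
      = Real.exp (-(l * Q.real T)) * (Q.real T * (Real.exp l - 1) + 1) := by ring
    _ ≤ Real.exp (-(l * Q.real T)) * Real.exp (Q.real T * (Real.exp l - 1)) := by gcongr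
    _ = Real.exp (Q.real T * (Real.exp l - 1 - l)) := by
        rw [← Real.exp_add]
        ring_nf
    _ ≤ _ := by gcongr

lemma pi_real_le_mul_sum_le (hT : MeasurableSet T) (n : ℕ) {ρ l : ℝ} (hq : Q.real T ≤ ρ)
    (hl : |l| ≤ 1) (hnl : n * ρ * l ^ 2 ≤ 1) (u : ℝ) :
    (Measure.pi fun _ : Fin n => Q).real
      {z | u ≤ l * (∑ i, T.indicator (fun _ => (1 : ℝ)) (z i) - n * Q.real T)} ≤
      Real.exp (1 - u) := by
  have hprod : ∀ z : Fin n → S,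
      Real.exp (1 * (l * (∑ i, T.indicator (fun _ => (1 : ℝ)) (z i) - n * Q.real T))) =
      ∏ i, Real.exp (l * (T.indicator (fun _ => (1 : ℝ)) (z i) - Q.real T)) := fun z => by
    rw [← Real.exp_sum, ← Finset.mul_sum, Finset.sum_sub_distrib, one_mul]
    simp
  have hint : Integrable (fun z : Fin n → S =>
      Real.exp (1 * (l * (∑ i, T.indicator (fun _ => (1 : ℝ)) (z i) - n * Q.real T))))
      (Measure.pi fun _ : Fin n => Q) := by
    simp only [hprod]
    exact Integrable.fintype_prod fun i => integrable_exp_mul_indicator_sub hT l _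
  refine (ProbabilityTheory.measure_ge_le_exp_mul_mgf u zero_le_one hint).trans ?_
  have hmgf : ProbabilityTheory.mgf
      (fun z : Fin n → S => l * (∑ i, T.indicator (fun _ => (1 : ℝ)) (z i) - n * Q.real T))
      (Measure.pi fun _ : Fin n => Q) 1 ≤ Real.exp 1 := by
    unfold ProbabilityTheory.mgf
    simp only [hprod]
    rw [integral_fintype_prod_eq_prod
      (fun _ x => Real.exp (l * (T.indicator (fun _ => (1 : ℝ)) x - Q.real T)))]
    simp only [Finset.prod_const, Finset.card_univ, Fintype.card_fin]
    calc _ ≤ Real.exp (Q.real T * l ^ 2) ^ n :=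
          pow_le_pow_left₀ (integral_nonneg fun x => (Real.exp_pos _).le)
            (integral_exp_mul_indicator_sub_le hT hl) n
      _ = Real.exp (n * (Q.real T * l ^ 2)) := (Real.exp_nat_mul _ n).symm
      _ ≤ Real.exp 1 := by
          refine Real.exp_le_exp.2 (le_trans ?_ hnl)
          rw [mul_assoc]
          gcongr
  calc _ ≤ Real.exp (-1 * u) * Real.exp 1 := by gcongr
    _ = _ := by
        rw [← Real.exp_add]
        ring_nf

/-- Chernoff with parameters `±1 / √(n ρ)`, admissible because `1 ≤ n ρ`; the moment generating
function is then at most `e`. The tail is only exponential in `u`, which costs no more than a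
logarithmic factor. -/
lemma pi_le_abs_sum_le (hT : MeasurableSet T) (n : ℕ) {ρ : ℝ} (hq : Q.real T ≤ ρ)
    (hn : 1 ≤ n * ρ) (u : ℝ) :
    (Measure.pi fun _ : Fin n => Q)
      {z | u * √(n * ρ) ≤ |∑ i, T.indicator (fun _ => (1 : ℝ)) (z i) - n * Q.real T|} ≤
      ENNReal.ofReal (2 * Real.exp (1 - u)) := by
  have hs : 1 ≤ √(n * ρ) := Real.one_le_sqrt.2 hn
  have hs0 : 0 < √(n * ρ) := by linarith
  have hsq : √(n * ρ) ^ 2 = n * ρ := Real.sq_sqrt (by linarith)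
  set l := (√(n * ρ))⁻¹ with hl
  have hl0 : 0 < l := inv_pos.2 hs0
  have hl1 : l ≤ 1 := inv_le_one_of_one_le₀ hs
  have hnl : n * ρ * l ^ 2 ≤ 1 := by
    rw [hl, inv_pow, hsq, mul_inv_cancel₀ (by linarith)]
  have h1 := pi_real_le_mul_sum_le hT n (l := l) hq (by rwa [abs_of_pos hl0]) hnl u
  have h2 := pi_real_le_mul_sum_le hT n (l := -l) hq (by rwa [abs_neg, abs_of_pos hl0])
    (by rwa [neg_sq]) u
  rw [ENNReal.le_ofReal_iff_toReal_le (measure_ne_top _ _) (by positivity), ← measureReal_def]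
  refine le_trans (measureReal_mono (s₂ := {z : Fin n → S | u ≤ l * (∑ i,
    T.indicator (fun _ => (1 : ℝ)) (z i) - n * Q.real T)} ∪ {z | u ≤ -l * (∑ i,
    T.indicator (fun _ => (1 : ℝ)) (z i) - n * Q.real T)}) ?_) ?_
  · intro z hz
    have hz' : u ≤ l * |∑ i, T.indicator (fun _ => (1 : ℝ)) (z i) - n * Q.real T| := by
      rw [hl, ← div_eq_inv_mul, le_div_iff₀ hs0]
      exact hz
    rcases abs_cases (∑ i, T.indicator (fun _ => (1 : ℝ)) (z i) - n * Q.real T) with h | h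
    · rw [h.1] at hz'
      exact Or.inl hz'
    · rw [h.1] at hz'
      refine Or.inr ?_
      simp only [mem_ofPred_eq]
      linarith
  · refine (measureReal_union_le _ _).trans ?_
    linarith

end Chernoff

/-! ### Concentration under active sampling, with a random region -/

section ActiveSample

variable {d : ℕ} {Ω : Type*} [mΩ : MeasurableSpace Ω] {μ : Measure Ω}
  {P : Measure ((Fin d → ℝ) × Bool)} {A : ℕ → Ω → Set (Fin d → ℝ)}
  {Z : ℕ → ℕ → Ω → (Fin d → ℝ) × Bool}

/-- `F` is a function of a countably-valued random variable that is measurable for `m₀`. -/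
def FactorsCountably {Ω α : Type*} (m₀ : MeasurableSpace Ω) (F : Ω → α) : Prop :=
  ∃ f : Ω → ℕ, Measurable[m₀] f ∧ ∀ ω ω', f ω = f ω' → F ω = F ω'

lemma IsActiveSample.pastData_le (h : IsActiveSample μ P A Z) (k : ℕ) : pastData Z k ≤ mΩ :=
  iSup_le fun j => iSup_le fun _ => iSup_le fun i => (h.measurable j i).comap_le

/-- On a past event where the region is constant, the integrand of `cond_law` is constant; the
normalised law on that event agrees with the product measure on rectangles, hence everywhere. -/
lemma IsActiveSample.measure_inter_eq [IsProbabilityMeasure μ] (h : IsActiveSample μ P A Z) {k : ℕ} {S : Set Ω}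
    (hS : MeasurableSet[pastData Z k] S) {B : Set (Fin d → ℝ)} (hB : ∀ ω ∈ S, A k ω = B)
    [IsProbabilityMeasure (ProbabilityTheory.cond P (B ×ˢ univ))] {n : ℕ}
    {E : Set (Fin n → (Fin d → ℝ) × Bool)} (hE : MeasurableSet E) :
    μ (S ∩ {ω | (fun i : Fin n => Z k i ω) ∈ E}) =
      μ S * Measure.pi (fun _ : Fin n => ProbabilityTheory.cond P (B ×ˢ univ)) E := by
  have hS' : MeasurableSet S := h.pastData_le k S hS
  have hφ : Measurable fun ω => fun i : Fin n => Z k i ω :=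
    measurable_pi_lambda _ fun i => h.measurable k i
  by_cases h0 : μ S = 0
  · rw [h0, zero_mul]
    exact measure_mono_null inter_subset_left h0
  have hpi : Measure.pi (fun _ : Fin n => ProbabilityTheory.cond P (B ×ˢ univ)) =
      (μ S)⁻¹ • (μ.restrict S).map fun ω => fun i : Fin n => Z k i ω := by
    refine Measure.pi_eq fun s hs => ?_
    rw [Measure.smul_apply, Measure.map_apply hφ (MeasurableSet.univ_pi hs),
      Measure.restrict_apply (hφ (MeasurableSet.univ_pi hs)), smul_eq_mul]
    have e : (fun ω => fun i : Fin n => Z k i ω) ⁻¹' (univ.pi s) ∩ S =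
        S ∩ {ω | ∀ i : Fin n, Z k i ω ∈ s i} := by
      ext ω
      simp [and_comm]
    rw [e, h.cond_law k S hS n s hs, setLIntegral_congr_fun (g := fun _ => ∏ i : Fin n,
      ProbabilityTheory.cond P (B ×ˢ univ) (s i)) hS' fun ω hω => by simp only [hB ω hω],
      setLIntegral_const, mul_comm _ (μ S), ← mul_assoc, ENNReal.inv_mul_cancel h0
      (measure_ne_top _ _), one_mul]
  rw [hpi, Measure.smul_apply, Measure.map_apply hφ hE, Measure.restrict_apply (hφ hE),
    smul_eq_mul, ← mul_assoc, ENNReal.mul_inv_cancel h0 (measure_ne_top _ _), one_mul, inter_comm]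
  rfl

/-- The past splits into countably many slices on which the region, and with it the sample size and
`ρ`, is fixed. The bound for a fixed region, weighted by the probability of each slice, sums to the
same bound. -/
lemma IsActiveSample.exists_frequency_close [IsProbabilityMeasure μ] [IsProbabilityMeasure P]
    (h : IsActiveSample μ P A Z) {k : ℕ}
    (hA : FactorsCountably (pastData Z k) (A k)) (hP : ∀ ω, P (A k ω ×ˢ univ) ≠ 0)
    {T : Set ((Fin d → ℝ) × Bool)} (hT : MeasurableSet T) (n : Set (Fin d → ℝ) → ℕ)
    (ρ : Set (Fin d → ℝ) → ℝ)
    (hρ : ∀ ω, (ProbabilityTheory.cond P (A k ω ×ˢ univ)).real T ≤ ρ (A k ω))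
    (hn : ∀ ω, 1 ≤ n (A k ω) * ρ (A k ω)) (u : ℝ) :
    ∃ E : Set Ω, MeasurableSet E ∧ μ Eᶜ ≤ ENNReal.ofReal (2 * Real.exp (1 - u)) ∧ ∀ ω ∈ E,
      |∑ j ∈ Finset.range (n (A k ω)), T.indicator (fun _ => (1 : ℝ)) (Z k j ω) -
        n (A k ω) * (ProbabilityTheory.cond P (A k ω ×ˢ univ)).real T| <
        u * √(n (A k ω) * ρ (A k ω)) := by
  obtain ⟨f, hf, hfA⟩ := hA
  set F : Set (Fin d → ℝ) → Set Ω := fun B => {ω | (fun i : Fin (n B) => Z k i ω) ∈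
    {z : Fin (n B) → (Fin d → ℝ) × Bool | u * √(n B * ρ B) ≤
      |∑ i, T.indicator (fun _ => (1 : ℝ)) (z i) -
        n B * (ProbabilityTheory.cond P (B ×ˢ univ)).real T|}} with hF
  have hEm : ∀ B, MeasurableSet {z : Fin (n B) → (Fin d → ℝ) × Bool | u * √(n B * ρ B) ≤
      |∑ i, T.indicator (fun _ => (1 : ℝ)) (z i) -
        n B * (ProbabilityTheory.cond P (B ×ˢ univ)).real T|} := fun B => by
    refine measurableSet_le measurable_const ?_
    refine Measurable.abs (Measurable.sub_const ?_ _)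
    exact Finset.measurable_sum _ fun i _ =>
      (measurable_const.indicator hT).comp (measurable_pi_apply i)
  have hFm : ∀ B, MeasurableSet (F B) := fun B =>
    (measurable_pi_lambda _ fun i : Fin (n B) => h.measurable k i) (hEm B)
  have hpast : ∀ a, MeasurableSet[pastData Z k] (f ⁻¹' {a}) :=
    fun a => hf (measurableSet_singleton a)
  have hS : ∀ a, MeasurableSet (f ⁻¹' {a}) := fun a => h.pastData_le k _ (hpast a)
  have key : ∀ a, ∃ G : Set Ω, MeasurableSet G ∧ G ⊆ f ⁻¹' {a} ∧
      μ G ≤ μ (f ⁻¹' {a}) * ENNReal.ofReal (2 * Real.exp (1 - u)) ∧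
      ∀ ω ∈ f ⁻¹' {a}, ω ∈ F (A k ω) → ω ∈ G := by
    intro a
    rcases (f ⁻¹' {a}).eq_empty_or_nonempty with he | ⟨ω₀, hω₀⟩
    · exact ⟨∅, MeasurableSet.empty, empty_subset _, by simp, fun ω hω => by simp [he] at hω⟩
    · have hB : ∀ ω ∈ f ⁻¹' {a}, A k ω = A k ω₀ := fun ω hω =>
        hfA ω ω₀ ((show f ω = a from hω).trans (show f ω₀ = a from hω₀).symm)
      have := ProbabilityTheory.cond_isProbabilityMeasure (hP ω₀)
      refine ⟨f ⁻¹' {a} ∩ F (A k ω₀), (hS a).inter (hFm _), inter_subset_left, ?_, ?_⟩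
      · rw [hF, h.measure_inter_eq (hpast a) hB (hEm _)]
        gcongr
        exact pi_le_abs_sum_le hT _ (hρ ω₀) (hn ω₀) u
      · intro ω hω hωF
        rw [hB ω hω] at hωF
        exact ⟨hω, hωF⟩
  choose G hGm hGsub hGμ hGF using key
  refine ⟨(⋃ a, G a)ᶜ, (MeasurableSet.iUnion hGm).compl, ?_, ?_⟩
  · rw [compl_compl]
    calc μ (⋃ a, G a) ≤ ∑' a, μ (G a) := measure_iUnion_le _
      _ ≤ ∑' a, μ (f ⁻¹' {a}) * ENNReal.ofReal (2 * Real.exp (1 - u)) :=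
          ENNReal.tsum_le_tsum hGμ
      _ = μ (⋃ a, f ⁻¹' {a}) * ENNReal.ofReal (2 * Real.exp (1 - u)) := by
          rw [ENNReal.tsum_mul_right, measure_iUnion _ hS]
          intro a b hab
          rw [Function.onFun, Set.disjoint_left]
          rintro ω h1 h2
          exact hab ((show f ω = a from h1).symm.trans h2)
      _ ≤ 1 * ENNReal.ofReal (2 * Real.exp (1 - u)) := by
          gcongr
          exact prob_le_one
      _ = _ := one_mul _
  · intro ω hω
    by_contra! hcon
    refine hω (mem_iUnion.2 ⟨f ω, hGF (f ω) ω rfl ?_⟩)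
    simp only [hF, mem_ofPred_eq]
    rwa [Fin.sum_univ_eq_sum_range (fun j => T.indicator (fun _ => (1 : ℝ)) (Z k j ω))]

end ActiveSample

/-! ### Step sizes, rejection rates and regions -/

section Steps

variable {d N : ℕ} {cN δ : ℝ}

lemma one_le_stepSize (hcN : 1 < cN) (hN : 1 ≤ N) (k : ℕ) : 1 ≤ stepSize cN N k := by
  induction k with
  | zero => exact Nat.sqrt_pos.2 hN
  | succ k ih =>
    have ih' : (1 : ℝ) ≤ stepSize cN N k := by exact_mod_cast ih
    refine Nat.le_floor ?_
    push_cast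
    nlinarith

lemma stepSize_le_succ (hcN : 1 < cN) (k : ℕ) :
    stepSize cN N k ≤ stepSize cN N (k + 1) :=
  Nat.le_floor (le_mul_of_one_le_left (Nat.cast_nonneg _) hcN.le)

lemma stepSize_mono (hcN : 1 < cN) : Monotone (stepSize cN N) :=
  monotone_nat_of_le_succ (stepSize_le_succ hcN)

lemma stepSize_succ_le (hcN : 1 < cN) (k : ℕ) :
    (stepSize cN N (k + 1) : ℝ) ≤ cN * stepSize cN N k :=
  Nat.floor_le (mul_nonneg (by linarith) (Nat.cast_nonneg _))

lemma bandwidth_pos (hcN : 1 < cN) (hN : 1 ≤ N) (k : ℕ) : 0 < bandwidth d cN N k :=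
  Real.rpow_pos_of_pos (by exact_mod_cast one_le_stepSize hcN hN k) _

lemma bandwidth_le_one (hcN : 1 < cN) (hN : 1 ≤ N) (k : ℕ) : bandwidth d cN N k ≤ 1 :=
  Real.rpow_le_one_of_one_le_of_nonpos (by exact_mod_cast one_le_stepSize hcN hN k)
    (neg_nonpos.2 (by positivity))

lemma bandwidth_anti (hcN : 1 < cN) (hN : 1 ≤ N) : Antitone (bandwidth d cN N) := fun j k hjk =>
  Real.rpow_le_rpow_of_nonpos (by exact_mod_cast one_le_stepSize hcN hN j)
    (by exact_mod_cast stepSize_mono hcN hjk) (neg_nonpos.2 (by positivity))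

/-- The identity that balances the two errors: a cell of volume `r ^ d` collects about `N_k r ^ d =
r⁻²` points, so noise and bias are both of order `r`. -/
lemma stepSize_mul_bandwidth_pow (hcN : 1 < cN) (hN : 1 ≤ N) (k : ℕ) :
    (stepSize cN N k : ℝ) * bandwidth d cN N k ^ (d + 2) = 1 := by
  have h : (0 : ℝ) < stepSize cN N k := by exact_mod_cast one_le_stepSize hcN hN k
  unfold bandwidth
  rw [← Real.rpow_natCast, ← Real.rpow_mul h.le]
  have : -(1 / ((d : ℝ) + 2)) * ((d + 2 : ℕ) : ℝ) = -1 := by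
    push_cast
    field_simp
  rw [this, Real.rpow_neg_one, mul_inv_cancel₀ h.ne']

lemma rejectionRate_succ (k : ℕ) : rejectionRate d cN N δ (k + 1) =
    min 1 (Real.log ((N : ℝ) / δ) * Real.log N * bandwidth d cN N k) := by
  simp only [rejectionRate, bandwidth, add_comm (2 : ℝ)]

lemma rejectionRate_le_one (k : ℕ) : rejectionRate d cN N δ k ≤ 1 := by
  cases k with
  | zero => exact le_rfl
  | succ k => exact min_le_left _ _

lemma log_div_nonneg (hN : 1 ≤ N) (hδ : 0 < δ) (hδ1 : δ < 1 / 2) : 0 ≤ Real.log ((N : ℝ) / δ) := by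
  have hN' : (1 : ℝ) ≤ N := by exact_mod_cast hN
  refine Real.log_nonneg ?_
  rw [le_div_iff₀ hδ]
  linarith

lemma rejectionRate_nonneg (hcN : 1 < cN) (hN : 1 ≤ N) (hδ : 0 < δ) (hδ1 : δ < 1 / 2) (k : ℕ) :
    0 ≤ rejectionRate d cN N δ k := by
  cases k with
  | zero => exact zero_le_one
  | succ k =>
    rw [rejectionRate_succ]
    exact le_min zero_le_one (mul_nonneg (mul_nonneg (log_div_nonneg hN hδ hδ1)
      (Real.log_natCast_nonneg N)) (bandwidth_pos hcN hN k).le)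

lemma rejectionRate_succ_le (hcN : 1 < cN) (hN : 1 ≤ N) (hδ : 0 < δ) (hδ1 : δ < 1 / 2) (k : ℕ) :
    rejectionRate d cN N δ (k + 1) ≤ rejectionRate d cN N δ k := by
  cases k with
  | zero => exact rejectionRate_le_one _
  | succ k =>
    rw [rejectionRate_succ, rejectionRate_succ]
    exact min_le_min le_rfl (mul_le_mul_of_nonneg_left (bandwidth_anti hcN hN k.le_succ)
      (mul_nonneg (log_div_nonneg hN hδ hδ1) (Real.log_natCast_nonneg N)))

variable {P : Measure ((Fin d → ℝ) × Bool)} {m : ℕ → ℕ} {D : ℕ → ℕ → (Fin d → ℝ) × Bool}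

lemma region_succ (k : ℕ) : region P N δ cN m D (k + 1) =
    {x | x ∈ region P N δ cN m D k ∧ (score (stepEstimator P N δ cN m D k) x : EReal) ≤
      threshold P.fst (region P N δ cN m D k) (score (stepEstimator P N δ cN m D k))
        (rejectionRate d cN N δ (k + 1))} := rfl

/-- The estimated score is constant on the cells of step `k`, and divisibility makes the next
partition a refinement of this one. -/
lemma region_isCellUnion (hm : ∀ k, 0 < m k) (hdvd : ∀ k, m k ∣ m (k + 1)) (k : ℕ) :
    IsCellUnion (m k) (region P N δ cN m D k) := by
  induction k with
  | zero => exact isCellUnion_unitCube _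
  | succ k ih =>
    refine IsCellUnion.of_dvd (m := m k) ⟨?_, ?_⟩ (hdvd k) (hm _)
    · exact fun x hx => ih.subset hx.1
    · rintro x hx z hz
      refine ⟨ih.cell_subset x hx.1 hz, ?_⟩
      have := hx.2
      simp only [score] at this ⊢
      rwa [histogram_eq_of_mem hz]

lemma measurable_stepEstimator (k : ℕ) : Measurable (stepEstimator P N δ cN m D k) :=
  measurable_histogram _ _ _ _ _

lemma measurable_score {f : (Fin d → ℝ) → ℝ} (hf : Measurable f) : Measurable (score f) :=
  hf.max (measurable_const.sub hf)

lemma region_anti : Antitone (region P N δ cN m D) :=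
  antitone_nat_of_succ_le fun _ _ hx => hx.1

/-- Keeps the regions from becoming too small to sample: the minimum in `min_le_real_le_threshold`
is the rejection rate, because the rates are nonincreasing. -/
lemma rejectionRate_le_real_region [IsProbabilityMeasure P] (hcN : 1 < cN) (hN : 1 ≤ N)
    (hδ : 0 < δ) (hδ1 : δ < 1 / 2) (hm : ∀ k, 0 < m k) (hdvd : ∀ k, m k ∣ m (k + 1))
    (hcube : P.fst.real (unitCube d) = 1) (k : ℕ) :
    rejectionRate d cN N δ k ≤ P.fst.real (region P N δ cN m D k) := by
  induction k with
  | zero => exact hcube.ge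
  | succ k ih =>
    rw [region_succ]
    refine le_trans (le_min ?_ le_rfl) (min_le_real_le_threshold
      (region_isCellUnion hm hdvd k).measurableSet
      (measurable_score (measurable_stepEstimator k)))
    exact (rejectionRate_succ_le hcN hN hδ hδ1 k).trans ih

end Steps

/-! ### Accuracy of one step of the algorithm -/

section Accuracy

variable {d : ℕ}

lemma histogram_congr {Pi : Measure (Fin d → ℝ)} {A : Set (Fin d → ℝ)} {n m : ℕ}
    {D D' : ℕ → (Fin d → ℝ) × Bool}
    (h : ∀ j < n, ((D j).1 ∈ unitCube d ↔ (D' j).1 ∈ unitCube d) ∧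
      gridIndex m (D j).1 = gridIndex m (D' j).1 ∧ (D j).2 = (D' j).2) :
    histogram Pi A n m D = histogram Pi A n m D' := by
  ext x
  unfold histogram
  congr 2
  refine Finset.sum_congr rfl fun j hj => ?_
  obtain ⟨h1, h2, h3⟩ := h j (Finset.mem_range.1 hj)
  have hiff : (D j).1 ∈ gridCell m x ↔ (D' j).1 ∈ gridCell m x := by
    rw [gridCell_eq_cellOf]
    simp only [cellOf, mem_ofPred_eq, h1, h2]
  rw [h3]
  by_cases hx : (D j).1 ∈ gridCell m x
  · rw [indicator_of_mem hx, indicator_of_mem (hiff.1 hx)]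
  · rw [indicator_of_notMem hx, indicator_of_notMem fun h => hx (hiff.2 h)]

/-- The information about a labelled point that the histogram rule uses. -/
noncomputable def pointCode (m : ℕ) (z : (Fin d → ℝ) × Bool) : Bool × (Fin d → ℕ) × Bool :=
  open Classical in (decide (z.1 ∈ unitCube d), gridIndex m z.1, z.2)

lemma measurable_pointCode (m : ℕ) : Measurable (pointCode (d := d) m) := by
  classical
  refine Measurable.prodMk ?_ (Measurable.prodMk ?_ measurable_snd)
  · refine measurable_to_bool ?_
    convert measurable_fst (measurableSet_unitCube (d := d))
    ext z
    simp
  · exact (measurable_gridIndex m).comp measurable_fst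

variable {N : ℕ} {cN δ : ℝ} {P : Measure ((Fin d → ℝ) × Bool)} {m : ℕ → ℕ}

lemma labelCount_le_stepSize [IsProbabilityMeasure P] (n : ℕ) (A : Set (Fin d → ℝ)) :
    labelCount P.fst n A ≤ n := by
  unfold labelCount
  refine Nat.floor_le_of_le ?_
  exact mul_le_of_le_one_right (Nat.cast_nonneg _) measureReal_le_one

lemma pastData_succ {Ω S : Type*} [MeasurableSpace S] (Z : ℕ → ℕ → Ω → S) (k : ℕ) :
    pastData Z k ≤ pastData Z (k + 1) :=
  iSup_mono fun _ => iSup_mono' fun h => ⟨Nat.lt_succ_of_lt h, le_rfl⟩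

lemma measurable_pastData {Ω S : Type*} [MeasurableSpace S] (Z : ℕ → ℕ → Ω → S) {j k : ℕ}
    (h : j < k) (i : ℕ) : Measurable[pastData Z k] (Z j i) := by
  refine Measurable.mono (comap_measurable (Z j i)) ?_ le_rfl
  exact le_iSup_of_le j (le_iSup_of_le h (le_iSup_of_le i le_rfl))

/-- The next region depends on the current one and on the codes of the points used at step `k`. The
number used is random but at most `N_k`, so the first `N_k` codes, a countable amount of
information, suffice. -/
lemma factorsCountably_region [IsProbabilityMeasure P] {Ω : Type*}
    (Z : ℕ → ℕ → Ω → (Fin d → ℝ) × Bool) (k : ℕ) :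
    FactorsCountably (pastData Z k) fun ω => region P N δ cN m (fun j i => Z j i ω) k := by
  induction k with
  | zero => exact ⟨fun _ => 0, measurable_const, fun _ _ _ => rfl⟩
  | succ k ih =>
    obtain ⟨f, hf, hfA⟩ := ih
    set g : Ω → (Fin (stepSize cN N k) → Bool × (Fin d → ℕ) × Bool) :=
      fun ω i => pointCode (m k) (Z k i ω) with hg
    have hgm : Measurable[pastData Z (k + 1)] g := by
      refine @measurable_pi_lambda _ _ _ (pastData Z (k + 1)) _ _ fun i => ?_
      exact (measurable_pointCode (m k)).comp (measurable_pastData Z k.lt_succ_self i)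
    let _ := Encodable.ofCountable (Fin (stepSize cN N k) → Bool × (Fin d → ℕ) × Bool)
    refine ⟨fun ω => Nat.pair (f ω) (Encodable.encode (g ω)), ?_, fun ω ω' h => ?_⟩
    · have h1 : Measurable[pastData Z (k + 1)] fun ω => (f ω, Encodable.encode (g ω)) :=
        Measurable.prodMk (hf.mono (pastData_succ Z k) le_rfl)
          ((Measurable.of_discrete (f := Encodable.encode)).comp hgm)
      exact (Measurable.of_discrete (f := fun p : ℕ × ℕ => Nat.pair p.1 p.2)).comp h1
    · obtain ⟨h1, h2⟩ := Nat.pair_eq_pair.1 h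
      have hA := hfA ω ω' h1
      have hG := Encodable.encode_injective h2
      simp only at hA
      have hH : histogram P.fst (region P N δ cN m (fun j i => Z j i ω) k)
          (labelCount P.fst (stepSize cN N k) (region P N δ cN m (fun j i => Z j i ω) k))
          (m k) (fun i => Z k i ω) =
        histogram P.fst (region P N δ cN m (fun j i => Z j i ω') k)
          (labelCount P.fst (stepSize cN N k) (region P N δ cN m (fun j i => Z j i ω') k))
          (m k) (fun i => Z k i ω') := by
        rw [hA]
        refine histogram_congr fun j hj => ?_
        have hj' : j < stepSize cN N k := hj.trans_le (labelCount_le_stepSize _ _)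
        have := congrFun hG ⟨j, hj'⟩
        simpa [hg, pointCode] using this
      simp only [region]
      rw [hH, hA]

lemma half_le_natFloor {a : ℝ} (ha : 1 ≤ a) : a / 2 ≤ ⌊a⌋₊ := by
  have h1 := Nat.lt_floor_add_one a
  have h2 : (1 : ℝ) ≤ ⌊a⌋₊ := by exact_mod_cast Nat.le_floor (by simpa using ha)
  linarith

variable {η : (Fin d → ℝ) → ℝ}

lemma abs_condMean_sub_le [IsProbabilityMeasure P] (h : IsRegressionFunction P η) {s : ℝ}
    (hs0 : 0 ≤ s) (hs : IsSmooth s η) {m : ℕ} (hm : 0 < m) {x : Fin d → ℝ} (hx : x ∈ unitCube d)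
    (hR : 0 < P.fst.real (gridCell m x)) :
    |P.real (gridCell m x ×ˢ {true}) / P.fst.real (gridCell m x) - η x| ≤ s * (1 / m) := by
  have hz : ∀ z ∈ gridCell m x, |η z - η x| ≤ s * (1 / m) := fun z hz =>
    (hs z hz.1 x hx).trans (mul_le_mul_of_nonneg_left (norm_sub_le_of_mem_gridCell hm hx hz) hs0)
  have h1 := real_prod_true_le h (measurableSet_gridCell m x) (b := η x + s * (1 / m))
    (add_nonneg (h.mem_Icc x hx).1 (by positivity))
    fun z hz' => by linarith [(abs_le.1 (hz z hz')).2]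
  have h2 := real_prod_true_ge h (measurableSet_gridCell m x) (a := η x - s * (1 / m))
    fun z hz' => by linarith [(abs_le.1 (hz z hz')).1]
  rw [abs_le]
  constructor
  · have := (le_div_iff₀ hR).2 h2
    linarith
  · have := (div_le_iff₀ hR).2 h1
    linarith

lemma cond_real_eq [IsProbabilityMeasure P] {B R : Set (Fin d → ℝ)} (hB : MeasurableSet B)
    (hR : R ⊆ B) : (ProbabilityTheory.cond P (B ×ˢ univ)).real (R ×ˢ {true}) =
      P.real (R ×ˢ {true}) / P.fst.real B := by
  rw [measureReal_def, ProbabilityTheory.cond_apply (hB.prod MeasurableSet.univ),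
    ENNReal.toReal_mul, ENNReal.toReal_inv, measureReal_def, measureReal_def,
    Measure.fst_apply hB, div_eq_inv_mul, ← prod_univ, prod_inter_prod, inter_eq_right.2 hR,
    univ_inter]

lemma cond_real_le [IsProbabilityMeasure P] {B R : Set (Fin d → ℝ)} (hB : MeasurableSet B)
    (hR : MeasurableSet R) : (ProbabilityTheory.cond P (B ×ˢ univ)).real (R ×ˢ {true}) ≤
      P.fst.real R / P.fst.real B := by
  rw [measureReal_def, ProbabilityTheory.cond_apply (hB.prod MeasurableSet.univ),
    ENNReal.toReal_mul, ENNReal.toReal_inv, measureReal_def, measureReal_def,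
    Measure.fst_apply hB, Measure.fst_apply hR, div_eq_inv_mul, ← prod_univ]
  gcongr
  · exact measure_ne_top _ _
  · exact fun z hz => hz.2.1

/-- Here `w` is a lower bound for `v = n Π(R) / Π(B)`, the expected number of points in the cell. As
the cell lies in `B`, the histogram is centred at the mean of `η` on the cell; noise contributes `u
/ √v` and the Lipschitz condition the rest. -/
lemma abs_histogram_sub_le [IsProbabilityMeasure P] (h : IsRegressionFunction P η) {s : ℝ}
    (hs0 : 0 ≤ s) (hs : IsSmooth s η) {m : ℕ} (hm : 0 < m) {B : Set (Fin d → ℝ)}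
    (hB : IsCellUnion m B) {x : Fin d → ℝ} (hx : x ∈ B) (hR : 0 < P.fst.real (gridCell m x))
    {n : ℕ} {w u : ℝ} (hw : 0 < w) (hu : 0 ≤ u)
    (hn : w ≤ n * (P.fst.real (gridCell m x) / P.fst.real B))
    {D : ℕ → (Fin d → ℝ) × Bool}
    (hD : |∑ j ∈ Finset.range n, (gridCell m x ×ˢ {true}).indicator (fun _ => (1 : ℝ)) (D j) -
      n * (ProbabilityTheory.cond P (B ×ˢ univ)).real (gridCell m x ×ˢ {true})| <
      u * √(n * (P.fst.real (gridCell m x) / P.fst.real B))) :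
    |histogram P.fst B n m D x - η x| ≤ u / √w + s * (1 / m) := by
  have hmean := abs_condMean_sub_le h hs0 hs hm (hB.subset hx) hR
  have hRB := hB.cell_subset x hx
  rw [cond_real_eq hB.measurableSet hRB] at hD
  have hBpos : 0 < P.fst.real B := hR.trans_le (measureReal_mono hRB)
  set R := gridCell m x with hRdef
  set S := ∑ j ∈ Finset.range n, (R ×ˢ {true}).indicator (fun _ => (1 : ℝ)) (D j) with hS
  set v := (n : ℝ) * (P.fst.real R / P.fst.real B) with hv
  have hv0 : 0 < v := hw.trans_le hn
  have hn0 : (0 : ℝ) < n := by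
    by_contra! hcon
    have : v ≤ 0 := mul_nonpos_of_nonpos_of_nonneg hcon (by positivity)
    linarith
  have hhist : histogram P.fst B n m D x = S / v := by
    have : ∀ j, (if (D j).2 then (1 : ℝ) else 0) * R.indicator (fun _ => (1 : ℝ)) (D j).1 =
        (R ×ˢ {true}).indicator (fun _ => (1 : ℝ)) (D j) := fun j => by
      by_cases h1 : (D j).1 ∈ R <;> by_cases h2 : (D j).2 = true <;>
        simp [indicator, h1, h2, mem_prod]
    unfold histogram
    rw [← hRdef]
    simp only [this]
    rw [← hS, hv]
    field_simp
  have hdev : |S / v - P.real (R ×ˢ {true}) / P.fst.real R| ≤ u / √w := by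
    have e : S / v - P.real (R ×ˢ {true}) / P.fst.real R =
        (S - n * (P.real (R ×ˢ {true}) / P.fst.real B)) / v := by
      rw [hv]
      field_simp
    rw [e, abs_div, abs_of_pos hv0, div_le_iff₀ hv0]
    refine hD.le.trans ?_
    have hsq : √v * √v = v := Real.mul_self_sqrt hv0.le
    have hswp : 0 < √w := Real.sqrt_pos.2 hw
    have hsw : √w ≤ √v := Real.sqrt_le_sqrt hn
    rw [div_mul_eq_mul_div, le_div_iff₀ hswp, mul_assoc]
    refine mul_le_mul_of_nonneg_left ?_ hu
    calc √v * √w ≤ √v * √v := by gcongr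
      _ = v := hsq
  rw [hhist]
  calc |S / v - η x| = |(S / v - P.real (R ×ˢ {true}) / P.fst.real R) +
        (P.real (R ×ˢ {true}) / P.fst.real R - η x)| := by ring_nf
    _ ≤ _ := (abs_add_le _ _).trans (add_le_add hdev hmean)

end Accuracy

/-! ### Uniform accuracy over all cells at one step -/

section StepAccuracy

variable {d N : ℕ} {cN δ : ℝ} {P : Measure ((Fin d → ℝ) × Bool)} {m : ℕ → ℕ}
  {η : (Fin d → ℝ) → ℝ} {Ω : Type*} [MeasurableSpace Ω] {μ : Measure Ω}
  {Z : ℕ → ℕ → Ω → (Fin d → ℝ) × Bool}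

lemma exists_stepEstimator_close [IsProbabilityMeasure μ] [IsProbabilityMeasure P]
    (h : IsRegressionFunction P η) {s μmin μmax κ : ℝ} (hs0 : 0 ≤ s) (hs : IsSmooth s η)
    (hμmin : 0 < μmin) (hPi : HasStrongDensity μmin μmax P.fst) (hcN : 1 < cN) (hN : 1 ≤ N)
    (hδ : 0 < δ) (hδ1 : δ < 1 / 2) (hκ : 1 ≤ κ) (hm0 : ∀ k, 0 < m k)
    (hdvd : ∀ k, m k ∣ m (k + 1)) {k : ℕ} (hm1 : bandwidth d cN N k / κ ≤ 1 / (m k : ℝ))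
    (hm2 : 1 / (m k : ℝ) ≤ κ * bandwidth d cN N k)
    (hmass : 1 ≤ stepSize cN N k * rejectionRate d cN N δ k)
    (hr : bandwidth d cN N k ^ 2 ≤ μmin / (2 * κ ^ d))
    (hact : IsActiveSample μ P (fun k ω => region P N δ cN m (fun j i => Z j i ω) k) Z)
    {u : ℝ} (hu : 0 ≤ u) :
    ∃ E : Set Ω, MeasurableSet E ∧
      μ Eᶜ ≤ ENNReal.ofReal (κ ^ d * stepSize cN N k * (2 * Real.exp (1 - u))) ∧
      ∀ ω ∈ E, ∀ x ∈ region P N δ cN m (fun j i => Z j i ω) k,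
        |stepEstimator P N δ cN m (fun j i => Z j i ω) k x - η x| ≤
          (u / √(μmin / (2 * κ ^ d)) + s * κ) * bandwidth d cN N k := by
  set r := bandwidth d cN N k with hrdef
  set c₀ := μmin / (2 * κ ^ d) with hc₀
  have hκ0 : 0 < κ := by linarith
  have hr0 : 0 < r := bandwidth_pos hcN hN k
  have hc0 : 0 < c₀ := by positivity
  have hNr : (stepSize cN N k : ℝ) * r ^ (d + 2) = 1 := stepSize_mul_bandwidth_pow hcN hN k
  have hmk : (0 : ℝ) < m k := by exact_mod_cast hm0 k
  set w := c₀ / r ^ 2 with hw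
  have hw1 : 1 ≤ w := by rwa [hw, le_div_iff₀ (by positivity), one_mul]
  have hcube := real_unitCube hPi
  have hRpos : ∀ x, 0 < P.fst.real (gridCell (m k) x) := fun x =>
    lt_of_lt_of_le (by positivity) (real_gridCell_ge hμmin hPi (hm0 k) x)
  have hreg : ∀ D, IsCellUnion (m k) (region P N δ cN m D k) :=
    fun D => region_isCellUnion hm0 hdvd k
  have hNB : ∀ D, 1 ≤ stepSize cN N k * P.fst.real (region P N δ cN m D k) := fun D =>
    hmass.trans (mul_le_mul_of_nonneg_left
      (rejectionRate_le_real_region hcN hN hδ hδ1 hm0 hdvd hcube k) (Nat.cast_nonneg _))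
  have hBpos : ∀ D, 0 < P.fst.real (region P N δ cN m D k) := fun D => by
    by_contra! hcon
    have := hNB D
    nlinarith [mul_nonpos_of_nonneg_of_nonpos (Nat.cast_nonneg (α := ℝ) (stepSize cN N k)) hcon]
  -- Rounding down the label count loses at most a factor 2, since `N_k Π(A_k) ≥ 1`; then `Π(A_k)`
  -- cancels, and the density bound on a cell of edge at least `r / κ` gives `w = c₀ / r ^ 2`.
  have hn : ∀ D x, w ≤ labelCount P.fst (stepSize cN N k) (region P N δ cN m D k) *
      (P.fst.real (gridCell (m k) x) / P.fst.real (region P N δ cN m D k)) := fun D x => by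
    have h1 : stepSize cN N k * P.fst.real (region P N δ cN m D k) / 2 ≤
        labelCount P.fst (stepSize cN N k) (region P N δ cN m D k) := half_le_natFloor (hNB D)
    have hB := hBpos D
    calc w = stepSize cN N k * (μmin * (r / κ) ^ d) / 2 := by
          rw [hw, hc₀, div_pow, div_eq_iff (by positivity)]
          field_simp
          rw [pow_add] at hNr
          linear_combination -hNr
      _ ≤ stepSize cN N k * (μmin * (1 / (m k : ℝ)) ^ d) / 2 := by gcongr
      _ ≤ stepSize cN N k * P.fst.real (gridCell (m k) x) / 2 := by
          gcongr
          exact real_gridCell_ge hμmin hPi (hm0 k) x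
      _ = stepSize cN N k * P.fst.real (region P N δ cN m D k) / 2 *
          (P.fst.real (gridCell (m k) x) / P.fst.real (region P N δ cN m D k)) := by
          field_simp
      _ ≤ _ := by gcongr
  have hPne : ∀ D, P (region P N δ cN m D k ×ˢ univ) ≠ 0 := fun D h0 => by
    have := hBpos D
    rw [measureReal_def, Measure.fst_apply (hreg D).measurableSet, ← prod_univ, h0] at this
    simp at this
  have hcell : ∀ v : Fin d → Fin (m k), ∃ E : Set Ω, MeasurableSet E ∧
      μ Eᶜ ≤ ENNReal.ofReal (2 * Real.exp (1 - u)) ∧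
      ∀ ω ∈ E, ∀ x ∈ region P N δ cN m (fun j i => Z j i ω) k,
        gridIndex (m k) x = (fun i => (v i : ℕ)) →
        |stepEstimator P N δ cN m (fun j i => Z j i ω) k x - η x| ≤
          u / √w + s * (1 / m k) := by
    intro v
    by_cases hv : ∃ y : Fin d → ℝ, gridIndex (m k) y = fun i => (v i : ℕ)
    · obtain ⟨y, hy⟩ := hv
      obtain ⟨E, hE, hμE, hdev⟩ := hact.exists_frequency_close (k := k)
        (factorsCountably_region Z k) (fun ω => hPne _)
        (T := gridCell (m k) y ×ˢ {true})
        ((measurableSet_gridCell _ _).prod (measurableSet_singleton _))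
        (fun B => labelCount P.fst (stepSize cN N k) B)
        (fun B => P.fst.real (gridCell (m k) y) / P.fst.real B)
        (fun ω => cond_real_le (hreg _).measurableSet (measurableSet_gridCell _ _))
        (fun ω => hw1.trans (hn _ y)) u
      refine ⟨E, hE, hμE, fun ω hω x hx hxv => ?_⟩
      have hxy : gridCell (m k) x = gridCell (m k) y := by
        rw [gridCell_eq_cellOf, gridCell_eq_cellOf, hxv, hy]
      have hD := hdev ω hω
      simp only [← hxy] at hD
      exact abs_histogram_sub_le h hs0 hs (hm0 k) (hreg _) hx (hRpos x) (by linarith) hu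
        (hn _ x) hD
    · exact ⟨univ, MeasurableSet.univ, by simp, fun ω _ x _ hx => absurd ⟨x, hx⟩ hv⟩
  choose E hE hμE hdev using hcell
  refine ⟨⋂ v, E v, MeasurableSet.iInter hE, ?_, fun ω hω x hx => ?_⟩
  · rw [compl_iInter]
    calc μ (⋃ v, (E v)ᶜ) ≤ ∑ v, μ (E v)ᶜ := measure_iUnion_fintype_le _ _
      _ ≤ ∑ _v : Fin d → Fin (m k), ENNReal.ofReal (2 * Real.exp (1 - u)) :=
          Finset.sum_le_sum fun v _ => hμE v
      _ = ENNReal.ofReal ((m k : ℝ) ^ d * (2 * Real.exp (1 - u))) := by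
          rw [Finset.sum_const, Finset.card_univ, Fintype.card_fun, Fintype.card_fin,
            Fintype.card_fin, nsmul_eq_mul,
            ENNReal.ofReal_mul (p := (m k : ℝ) ^ d) (by positivity)]
          congr 1
          rw [ENNReal.ofReal_pow (by positivity), ENNReal.ofReal_natCast, Nat.cast_pow]
      _ ≤ _ := by
          refine ENNReal.ofReal_le_ofReal (mul_le_mul_of_nonneg_right ?_ (by positivity))
          -- Counts the cells in terms of `N_k`: `m_k ≤ κ / r` and `r^{-d} = N_k r ^ 2 ≤ N_k`.
          have hmr : (m k : ℝ) * r ≤ κ := by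
            rw [div_le_div_iff₀ hκ0 hmk] at hm1
            linarith
          have hrle : r ≤ 1 := bandwidth_le_one hcN hN k
          calc (m k : ℝ) ^ d = (m k : ℝ) ^ d * (stepSize cN N k * r ^ (d + 2)) := by
                rw [hNr, mul_one]
            _ = (m k * r) ^ d * stepSize cN N k * r ^ 2 := by
                rw [mul_pow]
                ring
            _ ≤ κ ^ d * stepSize cN N k * 1 := by
                gcongr
                exact pow_le_one₀ hr0.le hrle
            _ = _ := mul_one _
  · refine (hdev (fun i => ⟨gridIndex (m k) x i, gridIndex_lt (hm0 k) x i⟩) ω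
      (mem_iInter.1 hω _) x hx rfl).trans ?_
    have h1 : √w = √c₀ / r := by
      rw [hw, Real.sqrt_div hc0.le, Real.sqrt_sq hr0.le]
    have h2 : 0 < √c₀ := Real.sqrt_pos.2 hc0
    calc u / √w + s * (1 / m k) ≤ u / (√c₀ / r) + s * (κ * r) := by
          rw [h1]
          gcongr
      _ = _ := by
          field_simp

end StepAccuracy

/-! ### Analysis of the algorithm on the event that all steps are accurate -/

section Growth

variable {d N : ℕ} {cN δ : ℝ}

/-- The unit lost to the floor is absorbed by half of the excess growth `cN - 1`, once `N_0` is
large. -/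
lemma stepSize_growth (hcN : 1 < cN) (hN0 : 1 ≤ (cN - 1) / 2 * stepSize cN N 0) (k : ℕ) :
    (1 + cN) / 2 * stepSize cN N k ≤ stepSize cN N (k + 1) := by
  have h1 : cN * (stepSize cN N k : ℝ) < stepSize cN N (k + 1) + 1 := Nat.lt_floor_add_one _
  have h2 : (stepSize cN N 0 : ℝ) ≤ stepSize cN N k := by
    exact_mod_cast stepSize_mono hcN (Nat.zero_le k)
  have h3 : (cN - 1) / 2 * (stepSize cN N 0 : ℝ) ≤ (cN - 1) / 2 * stepSize cN N k :=
    mul_le_mul_of_nonneg_left h2 (by linarith)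
  linarith

lemma pow_le_stepSize (hcN : 1 < cN) (hN : 1 ≤ N)
    (hN0 : 1 ≤ (cN - 1) / 2 * stepSize cN N 0) (k : ℕ) :
    ((1 + cN) / 2) ^ k ≤ stepSize cN N k := by
  induction k with
  | zero => simpa using one_le_stepSize hcN hN 0
  | succ k ih =>
    refine le_trans ?_ (stepSize_growth hcN hN0 k)
    rw [pow_succ, mul_comm]
    exact mul_le_mul_of_nonneg_left ih (by linarith)

lemma le_stepSize (hcN : 1 < cN) (hN0 : 1 ≤ (cN - 1) / 2 * stepSize cN N 0) (k : ℕ) :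
    k ≤ stepSize cN N k := by
  induction k with
  | zero => exact Nat.zero_le _
  | succ k ih =>
    have h1 := stepSize_growth hcN hN0 k
    have h2 : (stepSize cN N 0 : ℝ) ≤ stepSize cN N k := by
      exact_mod_cast stepSize_mono hcN (Nat.zero_le k)
    have h3 : (cN - 1) / 2 * (stepSize cN N 0 : ℝ) ≤ (cN - 1) / 2 * stepSize cN N k :=
      mul_le_mul_of_nonneg_left h2 (by linarith)
    have h4 : (stepSize cN N k : ℝ) + 1 ≤ stepSize cN N (k + 1) := by linarith
    have h5 : stepSize cN N k + 1 ≤ stepSize cN N (k + 1) := by exact_mod_cast h4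
    omega

lemma stepSize_mul_bandwidth_pow_eq (hcN : 1 < cN) (hN : 1 ≤ N) (k : ℕ) :
    ((stepSize cN N k : ℝ) * bandwidth d cN N k) ^ (d + 2) = (stepSize cN N k : ℝ) ^ (d + 1) := by
  have h := stepSize_mul_bandwidth_pow (d := d) hcN hN k
  rw [mul_pow, pow_succ _ (d + 1), mul_assoc, h, mul_one]

lemma stepSize_mul_bandwidth_mono (hcN : 1 < cN) (hN : 1 ≤ N) :
    Monotone fun k => (stepSize cN N k : ℝ) * bandwidth d cN N k := fun j k hjk => by
  refine le_of_pow_le_pow_left₀ (n := d + 2) (by omega)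
    (mul_nonneg (Nat.cast_nonneg _) (bandwidth_pos hcN hN k).le) ?_
  rw [stepSize_mul_bandwidth_pow_eq hcN hN, stepSize_mul_bandwidth_pow_eq hcN hN]
  gcongr
  exact stepSize_mono hcN hjk

lemma one_le_stepSize_mul_bandwidth (hcN : 1 < cN) (hN : 1 ≤ N) (k : ℕ) :
    1 ≤ (stepSize cN N k : ℝ) * bandwidth d cN N k := by
  refine le_of_pow_le_pow_left₀ (n := d + 2) (by omega)
    (mul_nonneg (Nat.cast_nonneg _) (bandwidth_pos hcN hN k).le) ?_
  rw [stepSize_mul_bandwidth_pow_eq hcN hN, one_pow]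
  exact one_le_pow₀ (by exact_mod_cast one_le_stepSize hcN hN k)

lemma log_le_log_div (hN : 1 ≤ N) (hδ : 0 < δ) (hδ1 : δ < 1 / 2) :
    Real.log N ≤ Real.log ((N : ℝ) / δ) := by
  have hN' : (1 : ℝ) ≤ N := by exact_mod_cast hN
  refine Real.log_le_log (by linarith) ?_
  rw [le_div_iff₀ hδ]
  nlinarith

lemma bandwidth_le_rejectionRate (hcN : 1 < cN) (hN : 1 ≤ N) (hδ : 0 < δ) (hδ1 : δ < 1 / 2)
    (hlog : 1 ≤ Real.log N) (k : ℕ) : bandwidth d cN N k ≤ rejectionRate d cN N δ k := by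
  cases k with
  | zero => exact bandwidth_le_one hcN hN 0
  | succ k =>
    rw [rejectionRate_succ]
    refine (bandwidth_anti hcN hN k.le_succ).trans (le_min (bandwidth_le_one hcN hN k) ?_)
    have h1 := log_le_log_div hN hδ hδ1
    exact le_mul_of_one_le_left (bandwidth_pos hcN hN k).le (by nlinarith)

lemma one_le_stepSize_mul_rejectionRate (hcN : 1 < cN) (hN : 1 ≤ N) (hδ : 0 < δ)
    (hδ1 : δ < 1 / 2) (hlog : 1 ≤ Real.log N) (k : ℕ) :
    1 ≤ stepSize cN N k * rejectionRate d cN N δ k :=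
  (one_le_stepSize_mul_bandwidth hcN hN k).trans (mul_le_mul_of_nonneg_left
    (bandwidth_le_rejectionRate hcN hN hδ hδ1 hlog k) (Nat.cast_nonneg _))

end Growth

/-! ### The steps allowed by the budget -/

section LastStep

variable {d N : ℕ} {cN δ : ℝ} {P : Measure ((Fin d → ℝ) × Bool)} [IsProbabilityMeasure P]
  {m : ℕ → ℕ} {D : ℕ → ℕ → (Fin d → ℝ) × Bool}

/-- The region has mass at least `r_k`, so the budget forces `N_k r_k ≤ 2 N`, that is `N_k ^ (d + 1)
≤ (2 N) ^ (d + 2)`. This holds for all data, so the range of steps in the union bound is fixed in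
advance. -/
lemma stepSize_le_sq_of_labelsUsed_le (hd : 1 ≤ d) (hcN : 1 < cN) (hN : 8 ≤ N) (hδ : 0 < δ)
    (hδ1 : δ < 1 / 2) (hlog : 1 ≤ Real.log N) (hm : ∀ k, 0 < m k) (hdvd : ∀ k, m k ∣ m (k + 1))
    (hcube : P.fst.real (unitCube d) = 1) {k : ℕ} (hk : labelsUsed P N δ cN m D k ≤ N) :
    stepSize cN N k ≤ N ^ 2 := by
  have hN1 : 1 ≤ N := by omega
  have h1 : labelCount P.fst (stepSize cN N k) (region P N δ cN m D k) ≤ N :=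
    (Finset.single_le_sum (f := fun j => labelCount P.fst (stepSize cN N j)
      (region P N δ cN m D j)) (fun _ _ => Nat.zero_le _)
      (Finset.self_mem_range_succ k)).trans hk
  have hmass : (stepSize cN N k : ℝ) * bandwidth d cN N k ≤
      stepSize cN N k * P.fst.real (region P N δ cN m D k) :=
    mul_le_mul_of_nonneg_left ((bandwidth_le_rejectionRate hcN hN1 hδ hδ1 hlog k).trans
      (rejectionRate_le_real_region hcN hN1 hδ hδ1 hm hdvd hcube k)) (Nat.cast_nonneg _)
  have h2 : (stepSize cN N k : ℝ) * P.fst.real (region P N δ cN m D k) / 2 ≤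
      labelCount P.fst (stepSize cN N k) (region P N δ cN m D k) :=
    half_le_natFloor ((one_le_stepSize_mul_bandwidth hcN hN1 k).trans hmass)
  have h3 : (labelCount P.fst (stepSize cN N k) (region P N δ cN m D k) : ℝ) ≤ N := by
    exact_mod_cast h1
  have h4 : (stepSize cN N k : ℝ) * bandwidth d cN N k ≤ 2 * N := by linarith
  have h5 : (stepSize cN N k : ℝ) ^ (d + 1) ≤ (2 * N) ^ (d + 2) := by
    rw [← stepSize_mul_bandwidth_pow_eq hcN hN1]
    exact pow_le_pow_left₀ (mul_nonneg (Nat.cast_nonneg _) (bandwidth_pos hcN hN1 k).le) h4 _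
  have h6 : stepSize cN N k ^ (d + 1) ≤ (2 * N) ^ (d + 2) := by exact_mod_cast h5
  refine le_of_pow_le_pow_left₀ (n := d + 1) (by omega) (Nat.zero_le _) (h6.trans ?_)
  have h7 : 2 ^ (d + 2) ≤ N ^ d := by
    calc 2 ^ (d + 2) ≤ 2 ^ (3 * d) := Nat.pow_le_pow_right (by norm_num) (by omega)
      _ = 8 ^ d := by rw [pow_mul]; norm_num
      _ ≤ N ^ d := Nat.pow_le_pow_left hN d
  calc (2 * N) ^ (d + 2) = 2 ^ (d + 2) * N ^ (d + 2) := mul_pow _ _ _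
    _ ≤ N ^ d * N ^ (d + 2) := Nat.mul_le_mul_right _ h7
    _ = (N ^ 2) ^ (d + 1) := by ring

lemma labelsUsed_zero_le : labelsUsed P N δ cN m D 0 ≤ N := by
  simp only [labelsUsed, zero_add, Finset.sum_range_one]
  exact (labelCount_le_stepSize _ _).trans (Nat.sqrt_le_self N)

lemma lastStep_spec (hd : 1 ≤ d) (hcN : 1 < cN) (hN : 8 ≤ N) (hδ : 0 < δ)
    (hδ1 : δ < 1 / 2) (hlog : 1 ≤ Real.log N) (hm : ∀ k, 0 < m k) (hdvd : ∀ k, m k ∣ m (k + 1))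
    (hcube : P.fst.real (unitCube d) = 1) (hN0 : 1 ≤ (cN - 1) / 2 * stepSize cN N 0) :
    labelsUsed P N δ cN m D (lastStep P N δ cN m D) ≤ N ∧
      N < labelsUsed P N δ cN m D (lastStep P N δ cN m D + 1) := by
  -- Without boundedness `sSup` on `ℕ` would take the default value `0` and `lastStep` would not be
  -- a maximum.
  have hbdd : BddAbove {k | labelsUsed P N δ cN m D k ≤ N} :=
    ⟨N ^ 2, fun k hk => (le_stepSize hcN hN0 k).trans
      (stepSize_le_sq_of_labelsUsed_le hd hcN hN hδ hδ1 hlog hm hdvd hcube hk)⟩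
  have h0 : (0 : ℕ) ∈ {k | labelsUsed P N δ cN m D k ≤ N} :=
    mem_ofPred_eq ▸ labelsUsed_zero_le
  have hmem : lastStep P N δ cN m D ∈ {k | labelsUsed P N δ cN m D k ≤ N} := by
    unfold lastStep
    exact Nat.sSup_mem ⟨0, h0⟩ hbdd
  refine ⟨by rwa [mem_ofPred_eq] at hmem, ?_⟩
  by_contra! hcon
  have h1 : lastStep P N δ cN m D + 1 ∈ {k | labelsUsed P N δ cN m D k ≤ N} := by
    rwa [mem_ofPred_eq]
  have h2 := le_csSup hbdd h1
  change _ ≤ lastStep P N δ cN m D at h2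
  exact absurd h2 (Nat.not_succ_le_self _)

end LastStep

/-! ### Correctness of rejections and mass of the uncertain regions -/

section Classifier

variable {d N : ℕ} {cN δ : ℝ} {P : Measure ((Fin d → ℝ) × Bool)}
  {m : ℕ → ℕ} {D : ℕ → ℕ → (Fin d → ℝ) × Bool} {η : (Fin d → ℝ) → ℝ}

lemma half_le_iff_of_abs_sub_le {a b Δ : ℝ} (h : |a - b| ≤ Δ) (hb : Δ < |b - 1 / 2|) :
    1 / 2 ≤ a ↔ 1 / 2 ≤ b := by
  have h1 := abs_le.1 h
  constructor
  · intro ha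
    by_contra! hcon
    rw [abs_of_neg (by linarith)] at hb
    linarith
  · intro hb'
    rw [abs_of_nonneg (by linarith)] at hb
    linarith

lemma finalEstimator_of_mem_diff {j : ℕ} (hj : j < lastStep P N δ cN m D) {x : Fin d → ℝ}
    (hx : x ∈ region P N δ cN m D j) (hx' : x ∉ region P N δ cN m D (j + 1)) :
    finalEstimator P N δ cN m D x = stepEstimator P N δ cN m D j x := by
  unfold finalEstimator
  rw [Finset.sum_eq_single j, indicator_of_mem (show x ∈ _ \ _ from ⟨hx, hx'⟩),
    indicator_of_notMem (fun h => hx' (region_anti (Nat.succ_le_of_lt hj) h)), add_zero]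
  · intro i _ hij
    refine indicator_of_notMem (fun h => ?_) _
    rcases lt_or_gt_of_ne hij with h1 | h1
    · exact h.2 (region_anti (Nat.succ_le_of_lt h1) hx)
    · exact hx' (region_anti (Nat.succ_le_of_lt h1) h.1)
  · exact fun h => absurd (Finset.mem_range.2 hj) h

lemma finalEstimator_of_mem {x : Fin d → ℝ}
    (hx : x ∈ region P N δ cN m D (lastStep P N δ cN m D)) :
    finalEstimator P N δ cN m D x = stepEstimator P N δ cN m D (lastStep P N δ cN m D) x := by
  unfold finalEstimator
  rw [Finset.sum_eq_zero, indicator_of_mem hx, zero_add]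
  intro i hi
  refine indicator_of_notMem (fun h => h.2 ?_) _
  exact region_anti (Nat.succ_le_of_lt (Finset.mem_range.1 hi)) hx

lemma exists_mem_diff_of_notMem {x : Fin d → ℝ} (hx : x ∈ unitCube d) {k : ℕ}
    (hk : x ∉ region P N δ cN m D k) :
    ∃ j < k, x ∈ region P N δ cN m D j ∧ x ∉ region P N δ cN m D (j + 1) := by
  induction k with
  | zero => exact absurd hx hk
  | succ k ih =>
    by_cases h : x ∈ region P N δ cN m D k
    · exact ⟨k, k.lt_succ_self, h, hk⟩
    · obtain ⟨j, hj, hj'⟩ := ih h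
      exact ⟨j, hj.trans k.lt_succ_self, hj'⟩

lemma measurable_finalEstimator (hm : ∀ k, 0 < m k) (hdvd : ∀ k, m k ∣ m (k + 1)) :
    Measurable (finalEstimator P N δ cN m D) := by
  unfold finalEstimator
  have hmeas := fun k => (region_isCellUnion (P := P) (N := N) (δ := δ) (cN := cN) (D := D)
    hm hdvd k).measurableSet
  refine Measurable.add ?_ ((measurable_stepEstimator _).indicator (hmeas _))
  exact Finset.measurable_sum _ fun j _ =>
    (measurable_stepEstimator j).indicator ((hmeas j).diff (hmeas (j + 1)))

variable [IsProbabilityMeasure P]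

lemma real_score_band_le {C a Δ : ℝ} (hη : AEMeasurable η P.fst)
    (hC : HasBoundedScoreDensity C P.fst (score η)) (hΔ : 0 ≤ Δ) :
    P.fst.real {x | |score η x - a| ≤ Δ} ≤ 2 * C * Δ := by
  refine (measureReal_mono ?_).trans
    ((real_score_mem_Icc_le hη hC (a := a - Δ) (b := a + Δ) (by linarith)).trans_eq (by ring))
  intro x hx
  have hx' : |score η x - a| ≤ Δ := hx
  have := abs_le.1 hx'
  exact ⟨by linarith, by linarith⟩

/-- Scores are at least `1 / 2`, so the band is one-sided and has length `Δ`. -/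
lemma real_near_half_le {C Δ : ℝ} (hη : AEMeasurable η P.fst)
    (hC : HasBoundedScoreDensity C P.fst (score η)) (hΔ : 0 ≤ Δ) :
    P.fst.real {x | |η x - 1 / 2| ≤ Δ} ≤ C * Δ := by
  refine (measureReal_mono ?_).trans
    ((real_score_mem_Icc_le hη hC (a := 1 / 2) (b := 1 / 2 + Δ) (by linarith)).trans_eq (by ring))
  intro x hx
  refine ⟨half_le_score x, ?_⟩
  rw [score_eq]
  have : |η x - 1 / 2| ≤ Δ := hx
  linarith

/-- A point that leaves the uncertain region after an accurate step is classified correctly. -/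
lemma half_le_stepEstimator_iff {C Δ : ℝ} (hη : AEMeasurable η P.fst)
    (hC : HasBoundedScoreDensity C P.fst (score η)) (hΔ : 0 ≤ Δ) {j : ℕ}
    (hε : min 1 (3 * C * Δ) ≤ rejectionRate d cN N δ (j + 1))
    (hgood : ∀ x ∈ region P N δ cN m D j, |stepEstimator P N δ cN m D j x - η x| ≤ Δ)
    {x : Fin d → ℝ} (hx : x ∈ region P N δ cN m D j) (hx' : x ∉ region P N δ cN m D (j + 1)) :
    1 / 2 ≤ stepEstimator P N δ cN m D j x ↔ 1 / 2 ≤ η x := by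
  refine half_le_iff_of_abs_sub_le (hgood x hx) ?_
  by_contra! hcon
  have hlt : threshold P.fst (region P N δ cN m D j) (score (stepEstimator P N δ cN m D j))
      (rejectionRate d cN N δ (j + 1)) < (score (stepEstimator P N δ cN m D j) x : EReal) := by
    by_contra! h
    exact hx' (by rw [region_succ]; exact ⟨hx, h⟩)
  have h1 := lt_real_of_threshold_lt hlt
  -- The true score of `x` is at most `1 / 2 + Δ`, and passing through the estimated scores of `x`
  -- and `z` costs `Δ` each: hence `3 Δ`.
  have h2 : P.fst.real {z | z ∈ region P N δ cN m D j ∧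
      (score (stepEstimator P N δ cN m D j) z : EReal) ≤
        (score (stepEstimator P N δ cN m D j) x : EReal)} ≤ min 1 (3 * C * Δ) := by
    refine le_min measureReal_le_one ?_
    refine (measureReal_mono ?_).trans ((real_near_half_le (Δ := 3 * Δ) hη hC
      (by linarith)).trans_eq (by ring))
    rintro z ⟨hz, hzx⟩
    have hzx' := EReal.coe_le_coe_iff.1 hzx
    have a1 := abs_le.1 ((abs_score_sub_score_le z).trans (hgood z hz))
    have a2 := abs_le.1 ((abs_score_sub_score_le x).trans (hgood x hx))
    have a3 := score_eq (η := η) z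
    have a4 := score_eq (η := η) x
    simp only [mem_ofPred_eq]
    linarith
  linarith

/-- Strictly below the threshold the mass is at most the rejection rate. Points tied at the
threshold have true scores within `Δ` of a single value, so the bounded score density controls the
plateau. -/
lemma real_region_succ_le {C Δ : ℝ} (hη : AEMeasurable η P.fst)
    (hC : HasBoundedScoreDensity C P.fst (score η)) (hC0 : 0 ≤ C) (hΔ : 0 ≤ Δ) {j : ℕ}
    (hε : 0 ≤ rejectionRate d cN N δ (j + 1))
    (hgood : ∀ x ∈ region P N δ cN m D j, |stepEstimator P N δ cN m D j x - η x| ≤ Δ) :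
    P.fst.real (region P N δ cN m D (j + 1)) ≤ rejectionRate d cN N δ (j + 1) + 2 * C * Δ := by
  rw [region_succ]
  set A := region P N δ cN m D j
  set f := score (stepEstimator P N δ cN m D j) with hf
  set ε := rejectionRate d cN N δ (j + 1)
  have hsplit : {x | x ∈ A ∧ (f x : EReal) ≤ threshold P.fst A f ε} ⊆
      {x | x ∈ A ∧ (f x : EReal) < threshold P.fst A f ε} ∪
      {x | x ∈ A ∧ (f x : EReal) = threshold P.fst A f ε} := fun x hx =>
    hx.2.lt_or_eq.imp (fun h => ⟨hx.1, h⟩) fun h => ⟨hx.1, h⟩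
  refine (measureReal_mono hsplit).trans ((measureReal_union_le _ _).trans
    (add_le_add (real_lt_threshold_le hε) ?_))
  rcases Set.eq_empty_or_nonempty {x | x ∈ A ∧ (f x : EReal) = threshold P.fst A f ε} with
    he | ⟨y, hyA, hy⟩
  · rw [he, measureReal_empty]
    positivity
  · refine (measureReal_mono ?_).trans (real_score_band_le (a := f y) hη hC hΔ)
    rintro x ⟨hxA, hx⟩
    have hxy : f x = f y := by
      rw [← hy] at hx
      exact_mod_cast hx
    have := (abs_score_sub_score_le x).trans (hgood x hxA)
    rw [← hf, hxy, abs_sub_comm] at this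
    exact this

end Classifier

/-! ### From the exhausted budget to the rate -/

section Rate

variable {d N : ℕ} {cN δ : ℝ} {P : Measure ((Fin d → ℝ) × Bool)} [IsProbabilityMeasure P]
  {m : ℕ → ℕ} {D : ℕ → ℕ → (Fin d → ℝ) × Bool} {η : (Fin d → ℝ) → ℝ}

lemma rpow_rate_le {d : ℕ} {r n b : ℝ} (hr : 0 < r) (hn : 0 < n) (hb : 1 ≤ b)
    (h : n * r ^ (d + 1) ≤ b) (hd : 1 ≤ d) : r ^ 2 ≤ b * n ^ (-(2 / (1 + (d : ℝ)))) := by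
  have hd' : (1 : ℝ) ≤ d := by exact_mod_cast hd
  have h1 : r ^ (d + 1) ≤ b * n⁻¹ := by
    rw [← div_eq_mul_inv, le_div_iff₀ hn]
    linarith
  have he : (0 : ℝ) ≤ 2 / (1 + (d : ℝ)) := by positivity
  calc r ^ 2 = (r ^ (d + 1)) ^ (2 / (1 + (d : ℝ))) := by
        rw [← Real.rpow_natCast r (d + 1), ← Real.rpow_mul hr.le, ← Real.rpow_natCast r 2]
        congr 1
        push_cast
        field_simp
        ring
    _ ≤ (b * n⁻¹) ^ (2 / (1 + (d : ℝ))) := Real.rpow_le_rpow (by positivity) h1 he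
    _ = b ^ (2 / (1 + (d : ℝ))) * n ^ (-(2 / (1 + (d : ℝ)))) := by
        rw [Real.mul_rpow (by linarith) (by positivity), Real.inv_rpow hn.le, Real.rpow_neg hn.le]
    _ ≤ b * n ^ (-(2 / (1 + (d : ℝ)))) := by
        gcongr
        calc b ^ (2 / (1 + (d : ℝ))) ≤ b ^ (1 : ℝ) := by
              refine Real.rpow_le_rpow_of_exponent_le hb ?_
              rw [div_le_one (by positivity)]
              linarith
          _ = b := Real.rpow_one b

/-- Step `0` costs at most `√N ≤ N / 2`. Step `j + 1` has `N_{j+1} ≤ cN N_j` and a region of mass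
`O(r_j)`, and `N_j r_j` increases with `j`, so each later step is bounded by the same quantity at
`k`. -/
lemma labelsUsed_succ_le {c : ℝ} (hcN : 1 < cN) (hN : 8 ≤ N) (hc : 0 ≤ c) {k : ℕ}
    (hreg : ∀ j ≤ k, P.fst.real (region P N δ cN m D (j + 1)) ≤ c * bandwidth d cN N j) :
    (labelsUsed P N δ cN m D (k + 1) : ℝ) ≤
      N / 2 + (k + 1) * (cN * c * (stepSize cN N k * bandwidth d cN N k)) := by
  have hN1 : 1 ≤ N := by omega
  have h0 : (labelCount P.fst (stepSize cN N 0) (region P N δ cN m D 0) : ℝ) ≤ N / 2 := by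
    have h1 : labelCount P.fst (stepSize cN N 0) (region P N δ cN m D 0) ≤ Nat.sqrt N :=
      labelCount_le_stepSize _ _
    have h2 : 2 ≤ Nat.sqrt N := Nat.le_sqrt.2 (by omega)
    have h3 : 2 * Nat.sqrt N ≤ N :=
      (Nat.mul_le_mul_right _ h2).trans (Nat.sqrt_le N)
    have h4 : 2 * labelCount P.fst (stepSize cN N 0) (region P N δ cN m D 0) ≤ N := by omega
    have h5 : (2 : ℝ) * labelCount P.fst (stepSize cN N 0) (region P N δ cN m D 0) ≤ N := by
      exact_mod_cast h4
    linarith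
  have hstep : ∀ j ∈ Finset.range (k + 1),
      (labelCount P.fst (stepSize cN N (j + 1)) (region P N δ cN m D (j + 1)) : ℝ) ≤
        cN * c * (stepSize cN N k * bandwidth d cN N k) := fun j hj => by
    have hjk : j ≤ k := Nat.lt_succ_iff.1 (Finset.mem_range.1 hj)
    calc (labelCount P.fst (stepSize cN N (j + 1)) (region P N δ cN m D (j + 1)) : ℝ)
        ≤ stepSize cN N (j + 1) * P.fst.real (region P N δ cN m D (j + 1)) :=
          Nat.floor_le (by positivity)
      _ ≤ (cN * stepSize cN N j) * (c * bandwidth d cN N j) :=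
          mul_le_mul (stepSize_succ_le hcN j) (hreg j hjk) measureReal_nonneg
            (mul_nonneg (by linarith) (Nat.cast_nonneg _))
      _ = cN * c * (stepSize cN N j * bandwidth d cN N j) := by ring
      _ ≤ _ := mul_le_mul_of_nonneg_left (stepSize_mul_bandwidth_mono hcN hN1 hjk)
          (mul_nonneg (by linarith) hc)
  unfold labelsUsed
  rw [Finset.sum_range_succ']
  push_cast
  have := Finset.sum_le_card_nsmul _ _ _ hstep
  rw [Finset.card_range, nsmul_eq_mul] at this
  push_cast at this
  linarith

lemma lastStep_add_one_le {k : ℕ} (hcN : 1 < cN) (hN : 1 ≤ N) (hlog : 1 ≤ Real.log N)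
    (hN0 : 1 ≤ (cN - 1) / 2 * stepSize cN N 0) (hk : stepSize cN N k ≤ N ^ 2) :
    (k : ℝ) + 1 ≤ (2 / Real.log ((1 + cN) / 2) + 1) * Real.log N := by
  have hb : 1 < (1 + cN) / 2 := by linarith
  have hlb := Real.log_pos hb
  have h1 : ((1 + cN) / 2) ^ k ≤ (N : ℝ) ^ 2 :=
    (pow_le_stepSize hcN hN hN0 k).trans (by exact_mod_cast hk)
  have h2 := Real.log_le_log (by positivity) h1
  rw [Real.log_pow, Real.log_pow] at h2
  have h3 : (k : ℝ) ≤ 2 / Real.log ((1 + cN) / 2) * Real.log N := by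
    rw [div_mul_eq_mul_div, le_div_iff₀ hlb]
    exact_mod_cast h2
  linarith

lemma risk_activeClassifier_sub_le (hd : 1 ≤ d) (hcN : 1 < cN) (hN : 8 ≤ N) (hδ : 0 < δ)
    (hδ1 : δ < 1 / 2) (hlog : 1 ≤ Real.log N) (hm : ∀ k, 0 < m k) (hdvd : ∀ k, m k ∣ m (k + 1))
    (hη : IsRegressionFunction P η) {s : ℝ} (hs : IsSmooth s η)
    (hcube : P.fst (unitCube d)ᶜ = 0) (hcube1 : P.fst.real (unitCube d) = 1) {C c : ℝ}
    (hC : HasBoundedScoreDensity C P.fst (score η)) (hC0 : 0 < C) (hc : 0 ≤ c)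
    (hclog : 3 * C * c ≤ Real.log N) (hN0 : 1 ≤ (cN - 1) / 2 * stepSize cN N 0)
    (hgood : ∀ k, stepSize cN N k ≤ N ^ 2 → ∀ x ∈ region P N δ cN m D k,
      |stepEstimator P N δ cN m D k x - η x| ≤
        c * Real.log ((N : ℝ) / δ) * bandwidth d cN N k) :
    risk P (activeClassifier P N δ cN m D) - risk P (plugIn η) ≤
      2 * C * c ^ 2 * (4 * cN * (2 / Real.log ((1 + cN) / 2) + 1)) *
        Real.log ((N : ℝ) / δ) ^ 5 * (N : ℝ) ^ (-(2 / (1 + (d : ℝ)))) := by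
  have hN1 : 1 ≤ N := by omega
  have hNpos : (0 : ℝ) < N := by exact_mod_cast hN1
  set ℓ := Real.log ((N : ℝ) / δ) with hℓ
  have hlogℓ : Real.log N ≤ ℓ := log_le_log_div hN1 hδ hδ1
  have hℓ1 : 1 ≤ ℓ := hlog.trans hlogℓ
  set L := lastStep P N δ cN m D with hL
  obtain ⟨hL1, hL2⟩ := lastStep_spec (D := D) hd hcN hN hδ hδ1 hlog hm hdvd hcube1 hN0
  rw [← hL] at hL1 hL2
  have hNL : stepSize cN N L ≤ N ^ 2 :=
    stepSize_le_sq_of_labelsUsed_le hd hcN hN hδ hδ1 hlog hm hdvd hcube1 hL1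
  have hgood' : ∀ j ≤ L, ∀ x ∈ region P N δ cN m D j,
      |stepEstimator P N δ cN m D j x - η x| ≤ c * ℓ * bandwidth d cN N j := fun j hj =>
    hgood j ((stepSize_mono hcN hj).trans hNL)
  have hr : ∀ k, 0 < bandwidth d cN N k := bandwidth_pos hcN hN1
  have hΔ : ∀ k, 0 ≤ c * ℓ * bandwidth d cN N k := fun k => by
    have := (hr k).le
    positivity
  have hCΔ : ∀ k, 3 * C * (c * ℓ * bandwidth d cN N k) ≤
      ℓ * Real.log N * bandwidth d cN N k := fun k => by
    have h1 : 0 ≤ ℓ * bandwidth d cN N k := mul_nonneg (by linarith) (hr k).le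
    have h2 := mul_le_mul_of_nonneg_right hclog h1
    linarith
  -- misclassified points lie close to the decision boundary
  have hmis : ∀ x ∈ unitCube d, plugIn (finalEstimator P N δ cN m D) x ≠ plugIn η x →
      |η x - 1 / 2| ≤ c * ℓ * bandwidth d cN N L := by
    intro x hx hne
    by_cases hxL : x ∈ region P N δ cN m D L
    · by_contra! hcon
      refine hne ?_
      have hiff := half_le_iff_of_abs_sub_le (hgood' L le_rfl x hxL) hcon
      simp only [plugIn, finalEstimator_of_mem hxL, ← hL, hiff]
    · obtain ⟨j, hjL, hxj, hxj'⟩ := exists_mem_diff_of_notMem hx hxL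
      refine absurd ?_ hne
      have hiff := half_le_stepEstimator_iff hη.aemeasurable hC (hΔ j)
        (by rw [rejectionRate_succ]; exact min_le_min le_rfl (hCΔ j)) (hgood' j hjL.le) hxj hxj'
      simp only [plugIn, finalEstimator_of_mem_diff hjL hxj hxj', hiff]
  have hmeas : MeasurableSet (unitCube d ∩ {x | 1 / 2 ≤ finalEstimator P N δ cN m D x}) :=
    measurableSet_unitCube.inter
      (measurableSet_le measurable_const (measurable_finalEstimator hm hdvd))
  have hexc : risk P (activeClassifier P N δ cN m D) - risk P (plugIn η) ≤
      2 * C * c ^ 2 * ℓ ^ 2 * bandwidth d cN N L ^ 2 := by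
    refine (risk_plugIn_sub_risk_le hη hs hcube hmeas hmis).trans ?_
    have h1 := mul_le_mul_of_nonneg_left
      (real_near_half_le hη.aemeasurable hC (hΔ L)) (hΔ L)
    linarith
  -- the last step size is large
  have hreg : ∀ j ≤ L, P.fst.real (region P N δ cN m D (j + 1)) ≤
      2 * (ℓ * Real.log N) * bandwidth d cN N j := fun j hj => by
    have h1 := real_region_succ_le hη.aemeasurable hC hC0.le (hΔ j)
      (rejectionRate_nonneg hcN hN1 hδ hδ1 (j + 1)) (hgood' j hj)
    have h2 : rejectionRate d cN N δ (j + 1) ≤ ℓ * Real.log N * bandwidth d cN N j := by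
      rw [rejectionRate_succ]
      exact min_le_right _ _
    have h3 := hCΔ j
    have h4 := mul_nonneg hC0.le (hΔ j)
    linarith
  have hcount := labelsUsed_succ_le hcN hN (by positivity) hreg
  have hL2' : (N : ℝ) < labelsUsed P N δ cN m D (L + 1) := by exact_mod_cast hL2
  have hsteps := lastStep_add_one_le hcN hN1 hlog hN0 hNL
  set a := (stepSize cN N L : ℝ) * bandwidth d cN N L with ha
  have ha1 : 1 ≤ a := one_le_stepSize_mul_bandwidth hcN hN1 L
  have har : a * bandwidth d cN N L ^ (d + 1) = 1 := by
    rw [ha, mul_assoc, ← pow_succ']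
    exact stepSize_mul_bandwidth_pow hcN hN1 L
  set b := 2 / Real.log ((1 + cN) / 2) + 1 with hb
  have hb1 : 1 ≤ b := by
    have := Real.log_pos (show 1 < (1 + cN) / 2 by linarith)
    have : 0 < 2 / Real.log ((1 + cN) / 2) := by positivity
    linarith
  -- The overrun at step `L + 1` reads `N < N / 2 + (L + 1) (…)`; moving `N / 2` to the left doubles
  -- the rest. One factor `ℓ` comes from the number of steps, two from the rejection rate. With `ℓ ^
  -- 2` from the squared accuracy, this makes the fifth power.
  have hNa : (N : ℝ) ≤ 4 * cN * b * ℓ ^ 3 * a := by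
    have h1 : (L + 1 : ℝ) * (cN * (2 * (ℓ * Real.log N)) * a) ≤
        (b * ℓ) * (cN * (2 * (ℓ * ℓ)) * a) := by
      refine mul_le_mul (hsteps.trans ?_) ?_ ?_ ?_
      · exact mul_le_mul_of_nonneg_left hlogℓ (by linarith)
      · gcongr
      · have : 0 < cN := by linarith
        positivity
      · positivity
    linarith
  have hrate := rpow_rate_le (d := d) (n := N) (b := 4 * cN * b * ℓ ^ 3) (hr L) hNpos (by
      have h1 : 1 ≤ ℓ ^ 3 := one_le_pow₀ hℓ1
      have h2 : 1 ≤ 4 * cN * b := by nlinarith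
      nlinarith)
    (by
      calc (N : ℝ) * bandwidth d cN N L ^ (d + 1) ≤
            4 * cN * b * ℓ ^ 3 * a * bandwidth d cN N L ^ (d + 1) :=
            mul_le_mul_of_nonneg_right hNa (pow_nonneg (hr L).le _)
        _ = 4 * cN * b * ℓ ^ 3 := by rw [mul_assoc, har, mul_one]) hd
  refine hexc.trans ?_
  calc 2 * C * c ^ 2 * ℓ ^ 2 * bandwidth d cN N L ^ 2
      ≤ 2 * C * c ^ 2 * ℓ ^ 2 * (4 * cN * b * ℓ ^ 3 * (N : ℝ) ^ (-(2 / (1 + (d : ℝ))))) := by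
        gcongr
    _ = _ := by ring

end Rate

/-! ### The event on which all relevant steps are accurate -/

section Event

variable {d N : ℕ} {cN δ : ℝ} {P : Measure ((Fin d → ℝ) × Bool)} {m : ℕ → ℕ}
  {η : (Fin d → ℝ) → ℝ} {Ω : Type*} [MeasurableSpace Ω] {μ : Measure Ω}
  {Z : ℕ → ℕ → Ω → (Fin d → ℝ) × Bool}

/-- The deviation level `6 ℓ` gives a factor `(δ / n) ^ 6`: two powers of `n` pay for the steps, two
for the cells of one step, one for the constant `12 K`. -/
lemma union_bound_arith {n ℓ δ K : ℝ} (hn : 1 ≤ n) (hδ : 0 < δ) (hδ1 : δ < 1 / 2)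
    (hℓ : ℓ = Real.log (n / δ)) (hK : 0 ≤ K) (hKn : 12 * K ≤ n) :
    (n ^ 2 + 1) * (K * n ^ 2 * (2 * Real.exp (1 - 6 * ℓ))) ≤ δ := by
  have h1 : Real.exp (1 - 6 * ℓ) = Real.exp 1 * (δ / n) ^ 6 := by
    rw [sub_eq_add_neg, Real.exp_add]
    congr 1
    rw [Real.exp_neg, show 6 * ℓ = ((6 : ℕ) : ℝ) * ℓ by norm_num, Real.exp_nat_mul, hℓ,
      Real.exp_log (by positivity), ← inv_pow, inv_div]
  have h2 : Real.exp 1 ≤ 3 := by linarith [Real.exp_one_lt_d9]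
  have h3 : n ^ 2 + 1 ≤ 2 * n ^ 2 := by nlinarith
  have h4 : δ ^ 6 ≤ δ := pow_le_of_le_one hδ.le (by linarith) (by norm_num)
  rw [h1]
  calc (n ^ 2 + 1) * (K * n ^ 2 * (2 * (Real.exp 1 * (δ / n) ^ 6)))
      ≤ (2 * n ^ 2) * (K * n ^ 2 * (2 * (3 * (δ / n) ^ 6))) := by gcongr
    _ = 12 * K * δ ^ 6 / n ^ 2 := by
        field_simp
        ring
    _ ≤ n * δ / n ^ 2 := by gcongr
    _ = δ / n := by field_simp
    _ ≤ δ := div_le_self hδ.le hn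

lemma exists_all_steps_close [IsProbabilityMeasure μ] [IsProbabilityMeasure P]
    (h : IsRegressionFunction P η) {s μmin μmax κ : ℝ} (hs0 : 0 ≤ s) (hs : IsSmooth s η)
    (hμmin : 0 < μmin) (hPi : HasStrongDensity μmin μmax P.fst) (hcN : 1 < cN) (hN : 1 ≤ N)
    (hδ : 0 < δ) (hδ1 : δ < 1 / 2) (hκ : 1 ≤ κ) (hm0 : ∀ k, 0 < m k)
    (hdvd : ∀ k, m k ∣ m (k + 1))
    (hm : ∀ k, bandwidth d cN N k / κ ≤ 1 / (m k : ℝ) ∧ 1 / (m k : ℝ) ≤ κ * bandwidth d cN N k)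
    (hlog : 1 ≤ Real.log N) (hN0 : 1 ≤ (cN - 1) / 2 * stepSize cN N 0)
    (hr : bandwidth d cN N 0 ^ 2 ≤ μmin / (2 * κ ^ d)) (hκN : 12 * κ ^ d ≤ N)
    (hact : IsActiveSample μ P (fun k ω => region P N δ cN m (fun j i => Z j i ω) k) Z) :
    ∃ E : Set Ω, MeasurableSet E ∧ ENNReal.ofReal (1 - δ) ≤ μ E ∧
      ∀ ω ∈ E, ∀ k, stepSize cN N k ≤ N ^ 2 →
        ∀ x ∈ region P N δ cN m (fun j i => Z j i ω) k,
          |stepEstimator P N δ cN m (fun j i => Z j i ω) k x - η x| ≤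
            (6 / √(μmin / (2 * κ ^ d)) + s * κ) * Real.log ((N : ℝ) / δ) *
              bandwidth d cN N k := by
  set ℓ := Real.log ((N : ℝ) / δ) with hℓ
  have hℓ1 : 1 ≤ ℓ := hlog.trans (log_le_log_div hN hδ hδ1)
  have hκ0 : 0 < κ := by linarith
  have hstep : ∀ k, ∃ E : Set Ω, MeasurableSet E ∧
      μ Eᶜ ≤ ENNReal.ofReal (κ ^ d * (N : ℝ) ^ 2 * (2 * Real.exp (1 - 6 * ℓ))) ∧
      ∀ ω ∈ E, stepSize cN N k ≤ N ^ 2 →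
        ∀ x ∈ region P N δ cN m (fun j i => Z j i ω) k,
          |stepEstimator P N δ cN m (fun j i => Z j i ω) k x - η x| ≤
            (6 / √(μmin / (2 * κ ^ d)) + s * κ) * ℓ * bandwidth d cN N k := by
    intro k
    have hrpos := bandwidth_pos (d := d) hcN hN k
    by_cases hk : stepSize cN N k ≤ N ^ 2
    · obtain ⟨E, hE, hμE, hdev⟩ := exists_stepEstimator_close h hs0 hs hμmin hPi hcN hN hδ hδ1 hκ
        hm0 hdvd (hm k).1 (hm k).2 (one_le_stepSize_mul_rejectionRate hcN hN hδ hδ1 hlog k)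
        ((pow_le_pow_left₀ hrpos.le (bandwidth_anti hcN hN (Nat.zero_le k)) 2).trans hr) hact
        (u := 6 * ℓ) (by linarith)
      refine ⟨E, hE, hμE.trans (ENNReal.ofReal_le_ofReal ?_), fun ω hω _ x hx =>
        (hdev ω hω x hx).trans ?_⟩
      · gcongr
        exact_mod_cast hk
      · have : s * κ ≤ s * κ * ℓ := le_mul_of_one_le_right (by positivity) hℓ1
        refine mul_le_mul_of_nonneg_right ?_ hrpos.le
        calc 6 * ℓ / √(μmin / (2 * κ ^ d)) + s * κ
            ≤ 6 * ℓ / √(μmin / (2 * κ ^ d)) + s * κ * ℓ := by gcongr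
          _ = _ := by ring
    -- Steps beyond `N ^ 2` need no event; since `k ≤ N_k`, only `N ^ 2 + 1` indices enter the union
    -- bound.
    · exact ⟨univ, MeasurableSet.univ, by simp, fun ω _ hk' => absurd hk' hk⟩
  choose E hE hμE hdev using hstep
  refine ⟨⋂ k ∈ Finset.range (N ^ 2 + 1), E k, Finset.measurableSet_biInter _ fun k _ => hE k,
    ?_, ?_⟩
  · have hcompl : μ (⋂ k ∈ Finset.range (N ^ 2 + 1), E k)ᶜ ≤ ENNReal.ofReal δ := by
      simp only [compl_iInter]
      calc μ (⋃ k ∈ Finset.range (N ^ 2 + 1), (E k)ᶜ)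
          ≤ ∑ k ∈ Finset.range (N ^ 2 + 1), μ (E k)ᶜ := measure_biUnion_finset_le _ _
        _ ≤ ∑ _k ∈ Finset.range (N ^ 2 + 1),
            ENNReal.ofReal (κ ^ d * (N : ℝ) ^ 2 * (2 * Real.exp (1 - 6 * ℓ))) :=
            Finset.sum_le_sum fun k _ => hμE k
        _ = ENNReal.ofReal (((N : ℝ) ^ 2 + 1) *
            (κ ^ d * (N : ℝ) ^ 2 * (2 * Real.exp (1 - 6 * ℓ)))) := by
            rw [Finset.sum_const, Finset.card_range, nsmul_eq_mul,
              ENNReal.ofReal_mul (p := (N : ℝ) ^ 2 + 1) (by positivity)]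
            congr 1
            rw [← ENNReal.ofReal_natCast]
            push_cast
            rfl
        _ ≤ ENNReal.ofReal δ := ENNReal.ofReal_le_ofReal
            (union_bound_arith (by exact_mod_cast hN) hδ hδ1 hℓ (by positivity) hκN)
    have hEm : MeasurableSet (⋂ k ∈ Finset.range (N ^ 2 + 1), E k) :=
      Finset.measurableSet_biInter _ fun k _ => hE k
    rw [ENNReal.ofReal_sub _ hδ.le, ENNReal.ofReal_one, tsub_le_iff_right]
    calc (1 : ENNReal) = μ (⋂ k ∈ Finset.range (N ^ 2 + 1), E k) +
          μ (⋂ k ∈ Finset.range (N ^ 2 + 1), E k)ᶜ := by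
          rw [measure_add_measure_compl hEm, measure_univ]
      _ ≤ _ := by gcongr
  · intro ω hω k hk
    have hkr : k ∈ Finset.range (N ^ 2 + 1) :=
      Finset.mem_range.2 (Nat.lt_succ_of_le ((le_stepSize hcN hN0 k).trans hk))
    exact hdev k ω (mem_iInter₂.1 hω k hkr) hk

end Event

lemma eventually_budget_large {cN : ℝ} (d : ℕ) (hcN : 1 < cN) (a b : ℝ) {c₀ : ℝ} (hc₀ : 0 < c₀) :
    ∀ᶠ N : ℕ in Filter.atTop, 8 ≤ N ∧ 1 ≤ Real.log N ∧ a ≤ Real.log N ∧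
      1 ≤ (cN - 1) / 2 * stepSize cN N 0 ∧ bandwidth d cN N 0 ^ 2 ≤ c₀ ∧ b ≤ N := by
  have hcast : Filter.Tendsto (fun N : ℕ => (N : ℝ)) Filter.atTop Filter.atTop :=
    tendsto_natCast_atTop_atTop
  have hlog := Real.tendsto_log_atTop.comp hcast
  have hsqrtN : Filter.Tendsto Nat.sqrt Filter.atTop Filter.atTop :=
    Filter.tendsto_atTop_atTop.2 fun n => ⟨n * n, fun k hk => Nat.le_sqrt.2 hk⟩
  have hsqrt := hcast.comp hsqrtN
  have hmul := hsqrt.const_mul_atTop (show 0 < (cN - 1) / 2 by linarith)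
  have hbw : Filter.Tendsto (fun N : ℕ => bandwidth d cN N 0 ^ 2) Filter.atTop (nhds 0) := by
    have h1 := (tendsto_rpow_neg_atTop (show 0 < 1 / ((d : ℝ) + 2) by positivity)).comp hsqrt
    have h2 := h1.pow 2
    simpa [bandwidth, stepSize, Function.comp_def] using h2
  filter_upwards [Filter.eventually_ge_atTop 8, hlog.eventually_ge_atTop 1,
    hlog.eventually_ge_atTop a, hmul.eventually_ge_atTop 1, hbw.eventually_le_const hc₀,
    hcast.eventually_ge_atTop b] with N h1 h2 h3 h4 h5 h6
  exact ⟨h1, h2, h3, h4, h5, h6⟩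

/-- The constant `32` offsets `log (N / δ) ^ 5 ≥ (1 / 2) ^ 5`, and `M` offsets `N^{-2/(1+d)} ≥ 1 /
N`, which uses `1 ≤ d`. -/
lemma one_le_small_budget_bound {d N M : ℕ} {δ K : ℝ} (hd : 1 ≤ d) (hN : 1 ≤ N) (hNM : N ≤ M)
    (hδ : 0 < δ) (hδ1 : δ < 1 / 2) (hK : 32 * (M : ℝ) ≤ K) :
    1 ≤ K * Real.log ((N : ℝ) / δ) ^ 5 * (N : ℝ) ^ (-(2 / (1 + (d : ℝ)))) := by
  have hN' : (1 : ℝ) ≤ N := by exact_mod_cast hN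
  have hNM' : (N : ℝ) ≤ M := by exact_mod_cast hNM
  have hd' : (1 : ℝ) ≤ d := by exact_mod_cast hd
  have h1 : 1 / 2 ≤ Real.log ((N : ℝ) / δ) := by
    have h2 : Real.log 2 ≤ Real.log ((N : ℝ) / δ) := by
      refine Real.log_le_log (by norm_num) ?_
      rw [le_div_iff₀ hδ]
      linarith
    linarith [Real.log_two_gt_d9]
  have h5 : (1 / 2 : ℝ) ^ 5 ≤ Real.log ((N : ℝ) / δ) ^ 5 := pow_le_pow_left₀ (by norm_num) h1 5
  have h6 : (N : ℝ)⁻¹ ≤ (N : ℝ) ^ (-(2 / (1 + (d : ℝ)))) := by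
    rw [← Real.rpow_neg_one]
    refine Real.rpow_le_rpow_of_exponent_le hN' ?_
    rw [neg_le_neg_iff, div_le_one (by positivity)]
    linarith
  have hK0 : 0 ≤ K := by linarith
  have hℓ0 : 0 ≤ Real.log ((N : ℝ) / δ) := by linarith
  calc (1 : ℝ) = 32 * N * (1 / 2) ^ 5 * (N : ℝ)⁻¹ := by
        field_simp
        norm_num
    _ ≤ K * Real.log ((N : ℝ) / δ) ^ 5 * (N : ℝ) ^ (-(2 / (1 + (d : ℝ)))) := by
        gcongr
        linarith

theorem theorem1 (d : ℕ) (hd : 1 ≤ d) (s μmin μmax C cN κ : ℝ) (hs : 0 ≤ s) (hμmin : 0 < μmin)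
    (hμmax : 0 < μmax) (hC : 0 < C) (hcN : 1 < cN) (hκ : 1 ≤ κ) :
    ∃ (K : ℝ) (p : ℕ), 0 < K ∧
      ∀ (P : Measure ((Fin d → ℝ) × Bool)) [IsProbabilityMeasure P] (η : (Fin d → ℝ) → ℝ),
        IsRegressionFunction P η →
        IsSmooth s η →
        HasStrongDensity μmin μmax P.fst →
        HasBoundedScoreDensity C P.fst (score η) →
      ∀ (N : ℕ) (δ : ℝ) (m : ℕ → ℕ), 1 ≤ N → 0 < δ → δ < 1 / 2 →
        (∀ k, m k ∣ m (k + 1)) →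
        (∀ k, bandwidth d cN N k / κ ≤ 1 / (m k : ℝ) ∧
          1 / (m k : ℝ) ≤ κ * bandwidth d cN N k) →
      ∀ {Ω : Type*} [MeasurableSpace Ω] (μ : Measure Ω) [IsProbabilityMeasure μ]
        (Z : ℕ → ℕ → Ω → (Fin d → ℝ) × Bool),
        IsActiveSample μ P (fun k ω => region P N δ cN m (fun j i => Z j i ω) k) Z →
        ∃ E : Set Ω, MeasurableSet E ∧ ENNReal.ofReal (1 - δ) ≤ μ E ∧
          ∀ ω ∈ E,
            risk P (activeClassifier P N δ cN m (fun j i => Z j i ω)) - risk P (plugIn η) ≤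
              K * Real.log ((N : ℝ) / δ) ^ p * (N : ℝ) ^ (-(2 / (1 + (d : ℝ)))) := by
  have hκ0 : 0 < κ := by linarith
  set c₀ := μmin / (2 * κ ^ d) with hc₀def
  have hc₀ : 0 < c₀ := by positivity
  set c := 6 / √c₀ + s * κ with hcdef
  have hc : 0 ≤ c := by positivity
  -- `M` depends only on the constants of the problem, not on `P`, `δ` or the partitions, so small
  -- budgets can be absorbed into `K`.
  obtain ⟨M, hM⟩ := Filter.eventually_atTop.1
    (eventually_budget_large d hcN (3 * C * c) (12 * κ ^ d) hc₀)
  set K₁ := 2 * C * c ^ 2 * (4 * cN * (2 / Real.log ((1 + cN) / 2) + 1)) with hK₁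
  refine ⟨max (max K₁ (32 * (M : ℝ))) 1, 5, lt_max_of_lt_right one_pos, ?_⟩
  intro P _ η hη hsm hPi hsc N δ m hN hδ hδ1 hdvd hm Ω _ μ _ Z hact
  have hN' : (1 : ℝ) ≤ N := by exact_mod_cast hN
  rcases lt_or_ge N M with hlt | hge
  · refine ⟨univ, MeasurableSet.univ, ?_, fun ω _ => ?_⟩
    · rw [measure_univ]
      exact ENNReal.ofReal_le_one.2 (by linarith)
    · refine le_trans ?_ (one_le_small_budget_bound hd hN hlt.le hδ hδ1
        ((le_max_right _ _).trans (le_max_left _ _)))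
      have h1 : risk P (activeClassifier P N δ cN m fun j i => Z j i ω) ≤ 1 := measureReal_le_one
      have h2 : 0 ≤ risk P (plugIn η) := measureReal_nonneg
      linarith
  · obtain ⟨hN8, hlog, hclog, hN0, hr, hκN⟩ := hM N hge
    -- Positivity is hidden in the lower bound on the edge length, because `1 / 0 = 0`.
    have hm0 : ∀ k, 0 < m k := fun k => by
      by_contra! h0
      have h1 : m k = 0 := by omega
      have h2 := (hm k).1
      rw [h1, Nat.cast_zero, div_zero] at h2
      exact absurd h2 (not_le.2 (div_pos (bandwidth_pos hcN hN k) hκ0))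
    obtain ⟨E, hE, hμE, hgood⟩ := exists_all_steps_close hη hs hsm hμmin hPi hcN hN hδ hδ1 hκ hm0
      hdvd hm hlog hN0 hr hκN hact
    refine ⟨E, hE, hμE, fun ω hω => ?_⟩
    refine (risk_activeClassifier_sub_le hd hcN hN8 hδ hδ1 hlog hm0 hdvd hη hsm
      (measure_compl_unitCube hPi) (real_unitCube hPi) hsc hC hc hclog hN0
      (hgood ω hω)).trans ?_
    have hℓ := log_div_nonneg hN hδ hδ1
    gcongr
    exact (le_max_left _ _).trans (le_max_left _ _)
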